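/- **Setting.** A self-similar system on $\mathbb{R}^m$ is a family $\Phi=\{\varphi_j\}_{j=1}^N$, $N\ge 2$, of maps with $|\varphi_j(x)-\varphi_j(y)|=r_j|x-y|$, $0<r_j<1$; $\mathbf r=(r_j)_{j=1}^N$ is its scaling vector and its attractor $F$ is the unique nonempty compact set with $F=\bigcup_j\varphi_j(F)$. The vector $\mathbf r$ (and $\Phi$) is *lattice* if there are $0<b<1$ and positive integers $k_j$ with $\gcd(k_1,\dots,k_N)=1$ and $r_j=b^{k_j}$ for all $j$; its oscillatory period is then $\mathbf p=2\pi/\log b^{-1}$. Otherwise it is *nonlattice*. The system $\Phi$ (and $F$) is *$\delta$-disjoint* if the sets $\varphi_j(F)$ are pairwise disjoint and $\delta=\sup\{\alpha: |x-y|>\alpha\ \forall x\in\varphi_j(F),\,y\in\varphi_k(F),\,j\ne k\}>0$. Let $\mathcal S_{\mathbf r}=\{\omega\in\mathbb C:\sum_j r_j^\omega=1\}$, each point counted with its multiplicity as a zero of $1-\sum_j r_j^s$. For a bounded infinite set $A\subset\mathbb{R}^m$ let $N_B(A,x)$ be the maximal number of disjoint closed balls with centers in $A$ and radius $x^{-1}$,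 let $M_1<M_2<\cdots$ be the values of $N_B(A,\cdot)$ on $(0,\infty)$, $x_n=\sup\{x>0:N_B(A,x)=M_n\}$, $l_n=x_n^{-1}$, $m_1=M_2$ and $m_n=M_{n+1}-M_n$ for $n\ge2$. The box-counting zeta function is $\zeta_B(s)=\sum_n m_n l_n^s$ for $\operatorname{Re}s$ greater than the abscissa of convergence, and the box-counting complex dimensions of $A$ are the poles of its meromorphic extension to $\mathbb C$, counted with their orders. For a $\delta$-disjoint $\Phi$ put $L(x)=N_B(F,x)-\sum_{j}N_B(F,r_jx)$, a step function on $(0,\infty)$ with finitely many jumps that vanishes for large $x$, and let $$h(s)=(N+L(x_1^+)-1)\,x_1^{-s}+\sum_{y>x_1}\bigl(L(y^+)-L(y)\bigr)\,y^{-s},$$ the sum being over the jumps $y>x_1$ of $L$; this is the numerator in the closed form $\zeta_B(s)=x_1^{-s}+h(s)/(1-\sum_j r_j^s)$. Let $X_M$ ($M\ge1$) and $X$ be sets of complex numbers with multiplicities, and let $\mathbf p_M$ be positive numbers (periods). We write $X_M\to X$ if there are $T_M\to\infty$ with $\mathbf p_M/T_M\to0$ such that for every $\varepsilon>0$ and all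 sufficiently large $M$ there is an injective assignment, to the points of $X$ with $|\operatorname{Im}\omega|<T_M$ (repeated according to multiplicity), of points of $X_M$ (repeated according to multiplicity) at distance less than $\varepsilon$, which reaches every point of $X_M$ with $|\operatorname{Im}\omega|<T_M-\varepsilon$. **Theorem.** Let $\Phi$ be a $\delta$-disjoint nonlattice self-similar system on $\mathbb{R}^m$ with attractor $F$, scaling vector $\mathbf r$ and set of box-counting complex dimensions $\mathcal D$, and suppose that $h(s)=0$ only if $s\notin\mathcal S_{\mathbf r}$. Then there are lattice self-similar systems $\Phi_M$ ($M\ge 1$) on $\mathbb{R}^m$, each consisting of $N$ maps, with scaling vectors $\mathbf r_M$, attractors $F_M$, oscillatory periods $\mathbf p_M$ and box-counting complex dimensions $\mathcal D_M$, such that as $M\to\infty$: 1. $\mathbf r_M\to\mathbf r$ componentwise; 2. $F_M\to F$ in the Hausdorff metric; 3. for all large enough $M$, $F_M$ is $\delta_M$-disjoint for some $\delta_M>0$, and $\delta_M\to\delta$; 4. $\mathcal D=\mathcal S_{\mathbf r}$, and $\mathcal S_{\mathbf r_M}\to\mathcal D$ in the above sense (with the periods $\mathbf p_M$); 5. if for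 some $M_0$ and all $M\ge M_0$ the system $\Phi_M$ is $\delta_M$-disjoint and its numerator $h_M$ (defined as $h$, from $\Phi_M$ and $F_M$) satisfies $h_M(s)=0$ only if $s\notin\mathcal S_{\mathbf r_M}$, then $\mathcal D_M=\mathcal S_{\mathbf r_M}$ for all $M\ge M_0$, and $\mathcal D_M\to\mathcal D$ in the above sense (with the periods $\mathbf p_M$). -/

import Mathlib

open Filter Topology

noncomputable section

namespace SelfSimilar

/-! ## Self-similar systems and their attractors -/

/-- A self-similar system on `ℝ^m`: `N ≥ 2` contracting similarities, listed with their scaling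
ratios; `ratio` is the scaling vector. -/
structure SelfSimilarSystem (m N : ℕ) where
  map : Fin N → EuclideanSpace ℝ (Fin m) → EuclideanSpace ℝ (Fin m)
  ratio : Fin N → ℝ
  two_le : 2 ≤ N
  ratio_pos : ∀ j, 0 < ratio j
  ratio_lt_one : ∀ j, ratio j < 1
  dist_map : ∀ j x y, dist (map j x) (map j y) = ratio j * dist x y

variable {m N : ℕ}

/-- `F` is the attractor of `Φ`: the (unique) nonempty compact set with `⋃ j, φ_j(F) = F`. -/
def IsAttractor (Φ : SelfSimilarSystem m N) (F : Set (EuclideanSpace ℝ (Fin m))) : Prop :=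
  F.Nonempty ∧ IsCompact F ∧ (⋃ j, Φ.map j '' F) = F

/-- `Φ`, with attractor `F`, is `δ`-disjoint: the images `φ_j(F)` are pairwise disjoint, and `δ` is
the supremum of the `α` such that points of distinct images are more than `α` apart, and `δ > 0`. -/
def IsDeltaDisjoint (Φ : SelfSimilarSystem m N) (F : Set (EuclideanSpace ℝ (Fin m)))
    (δ : ℝ) : Prop :=
  (∀ j k, j ≠ k → Disjoint (Φ.map j '' F) (Φ.map k '' F)) ∧
  IsLUB {α : ℝ | ∀ j k, j ≠ k → ∀ x ∈ Φ.map j '' F, ∀ y ∈ Φ.map k '' F, α < dist x y} δ ∧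
  0 < δ

/-! ## Lattice scaling vectors and the Moran equation -/

/-- `b ∈ (0,1)` and `r_j = b ^ k_j` for positive integers `k_j` of greatest common divisor one. -/
def IsLatticeGenerator (r : Fin N → ℝ) (b : ℝ) : Prop :=
  0 < b ∧ b < 1 ∧
    ∃ k : Fin N → ℕ, (∀ j, 0 < k j) ∧ Finset.univ.gcd k = 1 ∧ ∀ j, r j = b ^ k j

def IsLattice (r : Fin N → ℝ) : Prop := ∃ b, IsLatticeGenerator r b

open Classical in
/-- The oscillatory period `2π / log b⁻¹` of a lattice scaling vector with generator `b` (which is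
determined by the vector); set to `0` for a nonlattice vector. -/
def oscillatoryPeriod (r : Fin N → ℝ) : ℝ :=
  if h : IsLattice r then 2 * Real.pi / Real.log (h.choose)⁻¹ else 0

/-- The set `S_r` of complex solutions of the Moran equation. -/
def moranRoots (r : Fin N → ℝ) : Set ℂ := {ω | ∑ j, (r j : ℂ) ^ ω = 1}

/-- The multiplicity of `ω` as a zero of `1 - ∑ r_j ^ s` (zero if `ω` is not a root). -/
def rootMultiplicity (r : Fin N → ℝ) (ω : ℂ) : ℕ :=
  analyticOrderNatAt (fun s : ℂ => 1 - ∑ j, (r j : ℂ) ^ s) ω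

/-! ## Box-counting functions, box-counting fractal strings, complex dimensions -/

/-- `N_B(A, x)`: the maximal number of disjoint closed balls with centers in `A`, radius `x⁻¹`. -/
def boxCount (A : Set (EuclideanSpace ℝ (Fin m))) (x : ℝ) : ℕ :=
  sSup {n : ℕ | ∃ t : Finset (EuclideanSpace ℝ (Fin m)), (t : Set _) ⊆ A ∧ t.card = n ∧
    (t : Set (EuclideanSpace ℝ (Fin m))).PairwiseDisjoint (fun a => Metric.closedBall a x⁻¹)}

/-- The increasing enumeration of the range of `N_B(A, ·)` on `(0, ∞)`.  Indices start at `0`, so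
this is `M_{n+1}` in the usual notation `M_1 < M_2 < ⋯`; likewise for `x_n`, `l_n`, `m_n` below. -/
def boxValue (A : Set (EuclideanSpace ℝ (Fin m))) (n : ℕ) : ℕ :=
  Nat.nth (fun k => ∃ x : ℝ, 0 < x ∧ boxCount A x = k) n

/-- The points `x_n = sup {x > 0 : N_B(A, x) = M_n}` at which `N_B(A, ·)` jumps. -/
def boxJump (A : Set (EuclideanSpace ℝ (Fin m))) (n : ℕ) : ℝ :=
  sSup {x : ℝ | 0 < x ∧ boxCount A x = boxValue A n}

/-- The distinct lengths `l_n = x_n⁻¹` of the box-counting fractal string. -/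
def boxLength (A : Set (EuclideanSpace ℝ (Fin m))) (n : ℕ) : ℝ := (boxJump A n)⁻¹

/-- Their multiplicities: `m_1 = M_2` and `m_n = M_{n+1} - M_n` for `n ≥ 2`. -/
def boxMult (A : Set (EuclideanSpace ℝ (Fin m))) (n : ℕ) : ℕ :=
  if n = 0 then boxValue A 1 else boxValue A (n + 1) - boxValue A n

/-- The dimension (abscissa of convergence) of the box-counting fractal string of `A`. -/
def boxAbscissa (A : Set (EuclideanSpace ℝ (Fin m))) : ℝ :=
  sInf {α : ℝ | Summable fun n => (boxMult A n : ℝ) * boxLength A n ^ α}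

/-- The box-counting zeta function, used for `Re s > boxAbscissa A`. -/
def boxZeta (A : Set (EuclideanSpace ℝ (Fin m))) (s : ℂ) : ℂ :=
  ∑' n, (boxMult A n : ℂ) * (boxLength A n : ℂ) ^ s

/-- `g` is a meromorphic extension of the box-counting zeta function of `A` to all of `ℂ`. -/
def IsZetaExtension (A : Set (EuclideanSpace ℝ (Fin m))) (g : ℂ → ℂ) : Prop :=
  MeromorphicOn g Set.univ ∧ ∀ s : ℂ, boxAbscissa A < s.re → g s = boxZeta A s

/-- The set of box-counting complex dimensions of `A`: the poles of the meromorphic extension of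
its box-counting zeta function to `ℂ` (any two extensions have the same poles). -/
def complexDimensions (A : Set (EuclideanSpace ℝ (Fin m))) : Set ℂ :=
  {ω | ∃ g, IsZetaExtension A g ∧ meromorphicOrderAt g ω < 0}

open Classical in
/-- The multiplicity of a complex dimension: the order of the pole of the meromorphic extension
at `ω`, and `0` where there is no pole. -/
def dimensionMultiplicity (A : Set (EuclideanSpace ℝ (Fin m))) (ω : ℂ) : ℕ :=
  if h : ∃ g, IsZetaExtension A g then (-(meromorphicOrderAt h.choose ω).untop₀).toNat else 0

/-- The error term `L(x) = N_B(F, x) - ∑ N_B(F, r_j x)` of the renewal equation. -/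
def renewalError (Φ : SelfSimilarSystem m N) (F : Set (EuclideanSpace ℝ (Fin m))) (x : ℝ) : ℝ :=
  (boxCount F x : ℝ) - ∑ j, (boxCount F (Φ.ratio j * x) : ℝ)

/-- The numerator `h(s)` of the closed form
`ζ_B(s) = x_1^{-s} + h(s) / (1 - ∑ r_j ^ s)` of the box-counting zeta function:
`h(s) = (N + L(x_1+) - 1) x_1^{-s} + ∑_{y > x_1} (L(y+) - L(y)) y^{-s}`,
where `L` is the (step function) error term of the renewal equation and the finite sum is over its
jumps `y`; the last one is a jump from the last nonzero value of `L` to `0`. -/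
def numerator (Φ : SelfSimilarSystem m N) (F : Set (EuclideanSpace ℝ (Fin m))) (s : ℂ) : ℂ :=
  ((N : ℂ) + ((Function.rightLim (renewalError Φ F) (boxJump F 0) : ℝ) : ℂ) - 1) *
      (boxJump F 0 : ℂ) ^ (-s) +
    ∑ᶠ (y : ℝ) (_ : boxJump F 0 < y),
      ((Function.rightLim (renewalError Φ F) y - renewalError Φ F y : ℝ) : ℂ) * (y : ℂ) ^ (-s)

/-! ## Convergence of sets of roots, with multiplicities -/

/-- The points `ω` with `|Im ω| < T`, each one repeated according to its multiplicity. -/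
def pointsBelow (μ : ℂ → ℕ) (T : ℝ) : Set (ℂ × ℕ) := {q | q.2 < μ q.1 ∧ |q.1.im| < T}

/-- Approximation of a set of complex numbers with multiplicities `μ` by a sequence of such sets,
with multiplicities `μs M` and oscillatory periods `p M`.  On horizontal strips `|Im s| < T M`, whose
heights tend to infinity and are eventually much larger than the periods `p M`, the points of `μ` are
uniformly approximated by those of `μs M`, multiplicities being respected: for every `ε > 0`
and all large `M` there is a one-to-one assignment of points of `μs M` to the points of `μ` in the
strip that moves no point by `ε` or more, and it reaches all points of `μs M` with
`|Im s| < T M - ε`. -/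
def ApproximatedBy (μs : ℕ → ℂ → ℕ) (p : ℕ → ℝ) (μ : ℂ → ℕ) : Prop :=
  ∃ T : ℕ → ℝ, Tendsto T atTop atTop ∧ Tendsto (fun M => p M / T M) atTop (𝓝 0) ∧
    ∀ ε : ℝ, 0 < ε → ∀ᶠ M in atTop, ∃ f : ℂ × ℕ → ℂ × ℕ,
      Set.InjOn f (pointsBelow μ (T M)) ∧
      (∀ q ∈ pointsBelow μ (T M), (f q).2 < μs M (f q).1 ∧ dist (f q).1 q.1 < ε) ∧
      pointsBelow (μs M) (T M - ε) ⊆ f '' pointsBelow μ (T M)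

end SelfSimilar

end

open SelfSimilar

noncomputable section

namespace SelfSimilar
variable {m N : ℕ}

/-! ## The box-counting function -/

/-! The complex dimensions come from a renewal equation. For large x the pieces φ_j(F) are too far
apart for balls centred in different pieces to meet, so packings of F are unions of packings of the
pieces and L(x) = 0 (`renewal_equation`). Up to the term x_1^{-s}, ζ_B is the sum of gap · y^{-s}
over the jumps y of N_B; replacing y by r_j y multiplies this sum by r_j^s. Hence (ζ_B - x_1^{-s})(1
- ∑ r_j^s) is the finite exponential sum h (`boxZeta_mul_eq`). Since h has no zero among the Moran
roots, these are exactly the poles, with the same multiplicities (`complexDimensions_eq`,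
`dimensionMultiplicity_eq`).

The approximating systems keep the similarities and change only the ratios. Put w_j = -log r_j.
Simultaneous Diophantine approximation yields lattice weights w'_j for which |w'_j - w_j| times the
period tends to 0, so heights T can be chosen that are large against the period while |w'_j - w_j| T
still tends to 0 (`exists_lattice_sequence`). Contraction makes the attractor and the gaps between
its pieces depend continuously on the ratios (`attractor_stability`, `tendsto_attractor`).

The roots are compared by Rouché's theorem on the cells of a fine grid (`exists_zero_matching`). The
difficulty is uniformity: T grows, yet 1 - ∑ e^{-w_j s} must be bounded below on all cell boundaries
by one constant. A vertical translation only multiplies the exponentials by unimodular coefficients,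
and these form a compact torus, so good grid lines exist at every height with a common bound
(`exists_uniform_lower_bound`, `exists_grid`). Weights that coincide are kept equal, which confines
the roots of all nearby polynomials to one vertical strip (`exists_re_bound`). -/

/-- `t` consists of points of `A` that are the centers of disjoint closed balls of radius `x⁻¹`. -/
def IsPacking (A : Set (EuclideanSpace ℝ (Fin m))) (x : ℝ)
    (t : Finset (EuclideanSpace ℝ (Fin m))) : Prop :=
  (t : Set _) ⊆ A ∧ ∀ p ∈ t, ∀ q ∈ t, p ≠ q → x⁻¹ + x⁻¹ < dist p q

variable {A : Set (EuclideanSpace ℝ (Fin m))} {x y : ℝ} {t : Finset (EuclideanSpace ℝ (Fin m))}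

lemma isPacking_iff (hx : 0 < x) :
    IsPacking A x t ↔ (t : Set _) ⊆ A ∧
      (t : Set (EuclideanSpace ℝ (Fin m))).PairwiseDisjoint
        (fun a => Metric.closedBall a x⁻¹) := by
  have h : ∀ p q : EuclideanSpace ℝ (Fin m),
      Disjoint (Metric.closedBall p x⁻¹) (Metric.closedBall q x⁻¹) ↔ x⁻¹ + x⁻¹ < dist p q :=
    fun p q => disjoint_closedBall_closedBall_iff (by positivity) (by positivity)
  simp only [IsPacking, Set.PairwiseDisjoint, Set.Pairwise, Function.onFun, h, Finset.mem_coe]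
  
lemma boxCount_eq (hx : 0 < x) :
    boxCount A x = sSup {n : ℕ | ∃ t, IsPacking A x t ∧ t.card = n} := by
  unfold boxCount
  congr 1
  ext n
  simp only [isPacking_iff hx, Set.mem_ofPred_eq]
  exact exists_congr fun t => by tauto

/-- Among finitely many balls of radius x⁻¹ covering A, each contains at most one centre of a
packing. The bound makes the `sSup` in `boxCount` a maximum; for an unbounded set of naturals it
would be 0. -/
lemma exists_card_bound (hA : IsCompact A) (hx : 0 < x) :
    ∃ K : ℕ, ∀ t, IsPacking A x t → t.card ≤ K := by
  obtain ⟨s, -, hs, hcov⟩ := hA.finite_cover_balls (inv_pos.2 hx)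
  refine ⟨hs.toFinset.card, fun t ht => ?_⟩
  have : ∀ p ∈ t, ∃ c ∈ hs.toFinset, dist p c < x⁻¹ := by
    intro p hp
    obtain ⟨c, hc, hpc⟩ := Set.mem_iUnion₂.1 (hcov (ht.1 hp))
    exact ⟨c, hs.mem_toFinset.2 hc, hpc⟩
  choose! c hc hd using this
  refine Finset.card_le_card_of_injOn c hc fun p hp q hq hpq => ?_
  by_contra hne
  have h1 := ht.2 p hp q hq hne
  have h2 := dist_triangle_right p q (c p)
  have h3 := hd p hp
  have h4 := hd q hq
  rw [← hpq] at h4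
  linarith

lemma card_le_boxCount (hA : IsCompact A) (hx : 0 < x) (ht : IsPacking A x t) :
    t.card ≤ boxCount A x := by
  obtain ⟨K, hK⟩ := exists_card_bound hA hx
  rw [boxCount_eq hx]
  exact le_csSup ⟨K, by rintro n ⟨t, ht, rfl⟩; exact hK t ht⟩ ⟨t, ht, rfl⟩

lemma exists_packing_card_eq (hA : IsCompact A) (hx : 0 < x) :
    ∃ t, IsPacking A x t ∧ t.card = boxCount A x := by
  obtain ⟨K, hK⟩ := exists_card_bound hA hx
  rw [boxCount_eq hx]
  exact Nat.sSup_mem (s := {n : ℕ | ∃ t, IsPacking A x t ∧ t.card = n})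
    ⟨0, ∅, by simp [IsPacking], rfl⟩ ⟨K, by rintro n ⟨t, ht, rfl⟩; exact hK t ht⟩

lemma IsPacking.mono (hx : 0 < x) (hxy : x ≤ y) (ht : IsPacking A x t) : IsPacking A y t :=
  ⟨ht.1, fun p hp q hq hpq => by
    have := ht.2 p hp q hq hpq
    have := inv_anti₀ hx hxy
    linarith⟩

lemma boxCount_mono (hA : IsCompact A) (hx : 0 < x) (hxy : x ≤ y) :
    boxCount A x ≤ boxCount A y := by
  obtain ⟨t, ht, hc⟩ := exists_packing_card_eq hA hx
  exact hc ▸ card_le_boxCount hA (hx.trans_le hxy) (ht.mono hx hxy)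

lemma one_le_boxCount (hA : IsCompact A) (hne : A.Nonempty) (hx : 0 < x) : 1 ≤ boxCount A x := by
  obtain ⟨a, ha⟩ := hne
  refine le_trans (by simp) (card_le_boxCount (t := {a}) hA hx ⟨by simpa using ha, ?_⟩)
  intro p hp q hq hpq
  simp at hp hq
  exact absurd (hp.trans hq.symm) hpq

/-- Every packing is still a packing for slightly larger radii. -/
lemma exists_lt_boxCount_eq (hA : IsCompact A) (hx : 0 < x) :
    ∃ y, 0 < y ∧ y < x ∧ ∀ z, y ≤ z → z ≤ x → boxCount A z = boxCount A x := by
  obtain ⟨t, ht, hc⟩ := exists_packing_card_eq hA hx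
  have hev : ∀ᶠ y in 𝓝 x, ∀ p ∈ t, ∀ q ∈ t, p ≠ q → y⁻¹ + y⁻¹ < dist p q := by
    rw [Finset.eventually_all]
    intro p hp
    rw [Finset.eventually_all]
    intro q hq
    by_cases h : p = q
    · simp [h]
    have hcont : ContinuousAt (fun y : ℝ => y⁻¹ + y⁻¹) x :=
      (continuousAt_inv₀ hx.ne').add (continuousAt_inv₀ hx.ne')
    filter_upwards [hcont.eventually (gt_mem_nhds (ht.2 p hp q hq h))] with y hy _ using hy
  obtain ⟨y, ⟨⟨h1, h2⟩, h3⟩⟩ := (((hev.filter_mono nhdsWithin_le_nhds).and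
    ((lt_mem_nhds hx).filter_mono nhdsWithin_le_nhds)).and
    (self_mem_nhdsWithin : Set.Iio x ∈ 𝓝[<] x)).exists
  refine ⟨y, h2, h3, fun z hyz hzx => le_antisymm (boxCount_mono hA (h2.trans_le hyz) hzx) ?_⟩
  rw [← hc]
  exact card_le_boxCount hA (h2.trans_le hyz) (IsPacking.mono h2 hyz ⟨ht.1, h1⟩)

/-- Any n points of A become the centres of a packing once the radius is small. -/
lemma exists_boxCount_ge (hA : IsCompact A) (hinf : A.Infinite) (n : ℕ) :
    ∃ x, 0 < x ∧ n ≤ boxCount A x := by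
  obtain ⟨t, ht, hc⟩ := hinf.exists_subset_card_eq n
  have hev : ∀ᶠ x : ℝ in atTop, ∀ p ∈ t, ∀ q ∈ t, p ≠ q → x⁻¹ + x⁻¹ < dist p q := by
    rw [Finset.eventually_all]
    intro p hp
    rw [Finset.eventually_all]
    intro q hq
    by_cases h : p = q
    · simp [h]
    have hcont : Tendsto (fun y : ℝ => y⁻¹ + y⁻¹) atTop (𝓝 (0 + 0)) :=
      tendsto_inv_atTop_zero.add tendsto_inv_atTop_zero
    rw [add_zero] at hcont
    filter_upwards [hcont.eventually (gt_mem_nhds (dist_pos.2 h))] with y hy _ using hy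
  obtain ⟨x, h1, h2⟩ := (hev.and (eventually_gt_atTop 0)).exists
  exact ⟨x, h2, hc ▸ card_le_boxCount hA h2 ⟨ht, h1⟩⟩

lemma exists_boxCount_eq_one (hA : IsCompact A) (hne : A.Nonempty) :
    ∃ x, 0 < x ∧ boxCount A x = 1 := by
  obtain ⟨D, hD⟩ := hA.isBounded.subset_closedBall (0 : EuclideanSpace ℝ (Fin m))
  -- With radius at least D, two disjoint balls would have centres more than 2D apart, but A lies in
  -- a ball of radius D. The maximum with 1 keeps the radius positive.
  refine ⟨(max D 1)⁻¹, by positivity, ?_⟩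
  have hpos : (0 : ℝ) < (max D 1)⁻¹ := by positivity
  refine le_antisymm ?_ (one_le_boxCount hA hne hpos)
  obtain ⟨t, ht, hc⟩ := exists_packing_card_eq hA hpos
  rw [← hc, Finset.card_le_one]
  intro p hp q hq
  by_contra hpq
  have h1 := ht.2 p hp q hq hpq
  rw [inv_inv] at h1
  have h2 := dist_triangle_right p q 0
  have h3 : dist p 0 ≤ D := hD (ht.1 hp)
  have h4 : dist q 0 ≤ D := hD (ht.1 hq)
  have := le_max_left D 1
  linarith

/-! ### The values and the jumps of the box-counting function -/

lemma infinite_boxValues (hA : IsCompact A) (hinf : A.Infinite) :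
    {k | ∃ x : ℝ, 0 < x ∧ boxCount A x = k}.Infinite := by
  rw [Set.infinite_iff_exists_gt]
  intro n
  obtain ⟨x, hx, h⟩ := exists_boxCount_ge hA hinf (n + 1)
  exact ⟨_, ⟨x, hx, rfl⟩, h⟩

lemma boxValue_strictMono (hA : IsCompact A) (hinf : A.Infinite) : StrictMono (boxValue A) :=
  Nat.nth_strictMono (infinite_boxValues hA hinf)

lemma exists_boxCount_eq_boxValue (hA : IsCompact A) (hinf : A.Infinite) (n : ℕ) :
    ∃ x : ℝ, 0 < x ∧ boxCount A x = boxValue A n :=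
  Nat.nth_mem_of_infinite (infinite_boxValues hA hinf) n

lemma exists_boxValue_eq (hx : 0 < x) (hA : IsCompact A) (hinf : A.Infinite) :
    ∃ n, boxValue A n = boxCount A x := by
  have : boxCount A x ∈ Set.range (boxValue A) := by
    unfold boxValue
    rw [Nat.range_nth_of_infinite (infinite_boxValues hA hinf)]
    exact ⟨x, hx, rfl⟩
  exact this

lemma boxValue_zero (hA : IsCompact A) (hinf : A.Infinite) : boxValue A 0 = 1 := by
  obtain ⟨x, hx, h⟩ := exists_boxCount_eq_one hA hinf.nonempty
  obtain ⟨n, hn⟩ := exists_boxValue_eq hx hA hinf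
  obtain ⟨y, hy, h'⟩ := exists_boxCount_eq_boxValue hA hinf 0
  have h1 := one_le_boxCount hA hinf.nonempty hy
  have h2 := (boxValue_strictMono hA hinf).monotone (Nat.zero_le n)
  omega

/-- By left continuity (`exists_lt_boxCount_eq`) the supremum is attained, so the sublevel sets of
the monotone counting function are the half-open intervals (0, x_n]. Everything about the jumps
follows from this. -/
lemma boxCount_boxJump (hA : IsCompact A) (hinf : A.Infinite) (n : ℕ) :
    0 < boxJump A n ∧ boxCount A (boxJump A n) = boxValue A n ∧
      ∀ x, 0 < x → (x ≤ boxJump A n ↔ boxCount A x ≤ boxValue A n) := by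
  set S := {x : ℝ | 0 < x ∧ boxCount A x = boxValue A n} with hS
  obtain ⟨x₀, hx₀, hx₀'⟩ := exists_boxCount_eq_boxValue hA hinf n
  obtain ⟨x₁, hx₁, hx₁'⟩ := exists_boxCount_ge hA hinf (boxValue A n + 1)
  have hub : ∀ x, 0 < x → boxCount A x ≤ boxValue A n → x ≤ x₁ := by
    intro x hx h
    by_contra! hlt
    have := boxCount_mono hA hx₁ hlt.le
    omega
  have hbdd : BddAbove S := ⟨x₁, fun x hx => hub x hx.1 hx.2.le⟩
  have hle : x₀ ≤ boxJump A n := le_csSup hbdd ⟨hx₀, hx₀'⟩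
  have hpos : 0 < boxJump A n := hx₀.trans_le hle
  have heq : boxCount A (boxJump A n) = boxValue A n := by
    obtain ⟨y, hy, hyx, h⟩ := exists_lt_boxCount_eq hA hpos
    obtain ⟨z, hz, hyz⟩ := exists_lt_of_lt_csSup (⟨x₀, hx₀, hx₀'⟩ : S.Nonempty) hyx
    rw [← h z hyz.le (le_csSup hbdd hz), hz.2]
  refine ⟨hpos, heq, fun x hx => ⟨fun h => heq ▸ boxCount_mono hA hx h, fun h => ?_⟩⟩
  by_contra! hlt
  have := boxCount_mono hA hpos hlt.le
  exact absurd (le_csSup hbdd ⟨hx, le_antisymm h (heq ▸ this)⟩) hlt.not_ge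

lemma boxJump_strictMono (hA : IsCompact A) (hinf : A.Infinite) : StrictMono (boxJump A) := by
  refine strictMono_nat_of_lt_succ fun n => ?_
  obtain ⟨h1, h2, h3⟩ := boxCount_boxJump hA hinf n
  obtain ⟨h1', h2', h3'⟩ := boxCount_boxJump hA hinf (n + 1)
  rw [← not_le, h3 _ h1', h2', not_le]
  exact boxValue_strictMono hA hinf (Nat.lt_succ_self n)

lemma boxCount_eq_of_lt_of_le (hA : IsCompact A) (hinf : A.Infinite) {n : ℕ}
    (h1 : boxJump A n < x) (h2 : x ≤ boxJump A (n + 1)) : boxCount A x = boxValue A (n + 1) := by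
  obtain ⟨p, h3, h4⟩ := boxCount_boxJump hA hinf n
  obtain ⟨p', h3', h4'⟩ := boxCount_boxJump hA hinf (n + 1)
  have hx := p.trans h1
  refine le_antisymm ((h4' x hx).1 h2) ?_
  obtain ⟨k, hk⟩ := exists_boxValue_eq hx hA hinf
  rw [← not_le, h4 x hx, ← hk, not_le] at h1
  rw [← hk]
  exact (boxValue_strictMono hA hinf).monotone
    ((boxValue_strictMono hA hinf).lt_iff_lt.1 h1)

lemma boxCount_eq_one (hA : IsCompact A) (hinf : A.Infinite) (hx : 0 < x)
    (h : x ≤ boxJump A 0) : boxCount A x = 1 := by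
  rw [(boxCount_boxJump hA hinf 0).2.2 x hx, boxValue_zero hA hinf] at h
  exact le_antisymm h (one_le_boxCount hA hinf.nonempty hx)

lemma tendsto_boxJump (hA : IsCompact A) (hinf : A.Infinite) :
    Tendsto (boxJump A) atTop atTop := by
  refine tendsto_atTop_atTop_of_monotone (boxJump_strictMono hA hinf).monotone fun X => ?_
  have hX : 0 < max X 1 := lt_max_of_lt_right one_pos
  obtain ⟨n, hn⟩ := exists_boxValue_eq hX hA hinf
  exact ⟨n, (le_max_left X 1).trans (((boxCount_boxJump hA hinf n).2.2 _ hX).2 hn.ge)⟩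

lemma finite_boxJump_le (hA : IsCompact A) (hinf : A.Infinite) (X : ℝ) :
    {y | y ∈ Set.range (boxJump A) ∧ y ≤ X}.Finite := by
  obtain ⟨n, hn⟩ := ((tendsto_boxJump hA hinf).eventually_gt_atTop X).exists
  refine ((Set.finite_Iio n).image (boxJump A)).subset ?_
  rintro _ ⟨⟨k, rfl⟩, hk⟩
  exact ⟨k, (boxJump_strictMono hA hinf).lt_iff_lt.1 (hk.trans_lt hn), rfl⟩

/-- The jump of the box-counting function at `y > 0`. -/
def boxGap (A : Set (EuclideanSpace ℝ (Fin m))) (y : ℝ) : ℝ :=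
  if 0 < y then Function.rightLim (fun x => (boxCount A x : ℝ)) y - boxCount A y else 0

lemma tendsto_boxCount_right {z : ℝ} (hxz : x < z)
    (h : ∀ u, x < u → u ≤ z → boxCount A u = boxCount A z) :
    Tendsto (fun u => (boxCount A u : ℝ)) (𝓝[>] x) (𝓝 (boxCount A z)) := by
  refine tendsto_const_nhds.congr' ?_
  filter_upwards [Ioc_mem_nhdsGT hxz] with u hu
  rw [h u hu.1 hu.2]

/-- The counting function is constant just to the right of every point, which determines its right
limit both at jumps and elsewhere. -/
lemma boxCount_right_const (hA : IsCompact A) (hinf : A.Infinite) (hx : 0 < x) :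
    ∃ z, x < z ∧ (∀ u, x < u → u ≤ z → boxCount A u = boxCount A z) ∧
      (x ∉ Set.range (boxJump A) → boxCount A z = boxCount A x) ∧
      ∀ n, x = boxJump A n → boxCount A z = boxValue A (n + 1) := by
  have hinj := (boxJump_strictMono hA hinf).injective
  by_cases hr : x ∈ Set.range (boxJump A)
  · obtain ⟨n, rfl⟩ := hr
    have hlt := boxJump_strictMono hA hinf (Nat.lt_succ_self n)
    have hz := boxCount_eq_of_lt_of_le hA hinf hlt le_rfl
    refine ⟨boxJump A (n + 1), hlt, fun u h1 h2 => ?_, fun h => absurd ⟨n, rfl⟩ h, fun k hk => ?_⟩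
    · rw [boxCount_eq_of_lt_of_le hA hinf h1 h2, hz]
    · rw [← hinj hk]
      exact hz
  · obtain ⟨n, hn⟩ := exists_boxValue_eq hx hA hinf
    obtain ⟨p, h3, h4⟩ := boxCount_boxJump hA hinf n
    have hlt : x < boxJump A n := lt_of_le_of_ne ((h4 x hx).2 hn.ge) fun h => hr ⟨n, h.symm⟩
    refine ⟨boxJump A n, hlt, fun u h1 h2 => ?_, fun _ => by rw [h3, hn],
      fun k hk => absurd ⟨k, hk.symm⟩ hr⟩
    refine le_antisymm (boxCount_mono hA (hx.trans h1) h2) ?_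
    rw [h3, hn]
    exact boxCount_mono hA hx h1.le

lemma tendsto_boxCount_rightLim (hA : IsCompact A) (hinf : A.Infinite) (hx : 0 < x) :
    Tendsto (fun u => (boxCount A u : ℝ)) (𝓝[>] x) (𝓝 (boxCount A x + boxGap A x)) := by
  obtain ⟨z, hz, h, -⟩ := boxCount_right_const hA hinf hx
  have ht := tendsto_boxCount_right hz h
  rw [boxGap, if_pos hx, rightLim_eq_of_tendsto ht]
  simpa using ht

lemma boxGap_eq_zero (hA : IsCompact A) (hinf : A.Infinite) (h : x ∉ Set.range (boxJump A)) :
    boxGap A x = 0 := by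
  rw [boxGap]
  split_ifs with hx
  · obtain ⟨z, hz, h1, h2, -⟩ := boxCount_right_const hA hinf hx
    rw [rightLim_eq_of_tendsto (tendsto_boxCount_right hz h1), h2 h, sub_self]
  · rfl

lemma boxGap_boxJump (hA : IsCompact A) (hinf : A.Infinite) (n : ℕ) :
    boxGap A (boxJump A n) = boxValue A (n + 1) - boxValue A n := by
  obtain ⟨hx, h3, -⟩ := boxCount_boxJump hA hinf n
  obtain ⟨z, hz, h1, -, h2⟩ := boxCount_right_const hA hinf hx
  rw [boxGap, if_pos hx, rightLim_eq_of_tendsto (tendsto_boxCount_right hz h1), h2 n rfl, h3]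

lemma boxGap_of_nonpos (h : x ≤ 0) : boxGap A x = 0 := if_neg h.not_gt

/-! ### The box-counting zeta function as a sum over the jumps -/

/-- The convention m_1 = M_2 exceeds the true jump M_2 - M_1 by M_1 = 1. This excess produces the
separate term x_1^{-s} of the closed form. -/
lemma boxMult_eq (hA : IsCompact A) (hinf : A.Infinite) (n : ℕ) :
    (boxMult A n : ℝ) = boxGap A (boxJump A n) + if n = 0 then 1 else 0 := by
  rw [boxGap_boxJump hA hinf, boxMult]
  split_ifs with h
  · subst h
    simp [boxValue_zero hA hinf]
  · rw [Nat.cast_sub (boxValue_strictMono hA hinf (Nat.lt_succ_self n)).le, add_zero]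

lemma inv_ofReal_cpow (hx : 0 < x) (s : ℂ) : ((x⁻¹ : ℝ) : ℂ) ^ s = (x : ℂ) ^ (-s) := by
  rw [Complex.ofReal_inv, Complex.inv_cpow, Complex.cpow_neg]
  rw [Complex.arg_ofReal_of_nonneg hx.le]
  exact Real.pi_pos.ne

lemma norm_boxZeta_term (hA : IsCompact A) (hinf : A.Infinite) (n : ℕ) (s : ℂ) :
    ‖(boxMult A n : ℂ) * (boxLength A n : ℂ) ^ s‖ = boxMult A n * boxLength A n ^ s.re := by
  rw [norm_mul, Complex.norm_natCast, Complex.norm_cpow_eq_rpow_re_of_pos]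
  exact inv_pos.2 (boxCount_boxJump hA hinf n).1

/-- Summing over all real y, with zero terms off the jumps, makes multiplication by a ratio a
bijection of the index set, as the renewal argument needs. -/
lemma hasSum_boxGap (hA : IsCompact A) (hinf : A.Infinite) {s : ℂ}
    (hs : Summable fun n => (boxMult A n : ℝ) * boxLength A n ^ s.re) :
    HasSum (fun y : ℝ => (boxGap A y : ℂ) * (y : ℂ) ^ (-s))
      (boxZeta A s - (boxJump A 0 : ℂ) ^ (-s)) := by
  have h1 : Summable fun n => (boxMult A n : ℂ) * (boxLength A n : ℂ) ^ s := by
    refine Summable.of_norm ?_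
    simpa only [norm_boxZeta_term hA hinf] using hs
  have h2 := h1.hasSum.sub (hasSum_ite_eq 0 ((boxJump A 0 : ℂ) ^ (-s)))
  rw [← Function.Injective.hasSum_iff (boxJump_strictMono hA hinf).injective]
  · suffices h4 : ∀ n, ((fun y : ℝ => (boxGap A y : ℂ) * (y : ℂ) ^ (-s)) ∘ boxJump A) n =
        (boxMult A n : ℂ) * (boxLength A n : ℂ) ^ s -
          if n = 0 then (boxJump A 0 : ℂ) ^ (-s) else 0 by
      rw [funext h4]
      exact h2
    intro n
    have := boxMult_eq hA hinf n
    have h3 : (boxMult A n : ℂ) = boxGap A (boxJump A n) + if n = 0 then 1 else 0 := by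
      rw [← Complex.ofReal_natCast, this]
      split_ifs <;> simp
    rw [h3, boxLength, inv_ofReal_cpow (boxCount_boxJump hA hinf n).1]
    simp only [Function.comp]
    split_ifs with h
    · subst h
      ring
    · ring
  · intro y hy
    rw [boxGap_eq_zero hA hinf hy]
    simp

end SelfSimilar

namespace SelfSimilar
variable {m N : ℕ}

/-! ### The renewal equation -/

variable {Φ : SelfSimilarSystem m N} {F : Set (EuclideanSpace ℝ (Fin m))}

/-- The jump of the error term of the renewal equation at `y > 0`. -/
def renewalGap (Φ : SelfSimilarSystem m N) (F : Set (EuclideanSpace ℝ (Fin m))) (y : ℝ) : ℝ :=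
  boxGap F y - ∑ j, boxGap F (Φ.ratio j * y)

lemma tendsto_renewalError_right (hc : IsCompact F) (hinf : F.Infinite) {y : ℝ} (hy : 0 < y) :
    Tendsto (renewalError Φ F) (𝓝[>] y) (𝓝 (renewalError Φ F y + renewalGap Φ F y)) := by
  have h1 := tendsto_boxCount_rightLim hc hinf hy
  have h2 : ∀ j ∈ Finset.univ, Tendsto (fun u => (boxCount F (Φ.ratio j * u) : ℝ)) (𝓝[>] y)
      (𝓝 (boxCount F (Φ.ratio j * y) + boxGap F (Φ.ratio j * y))) := by
    intro j _
    refine (tendsto_boxCount_rightLim hc hinf (mul_pos (Φ.ratio_pos j) hy)).comp ?_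
    refine tendsto_nhdsWithin_iff.2 ⟨?_, ?_⟩
    · exact tendsto_nhdsWithin_of_tendsto_nhds (tendsto_id.const_mul (Φ.ratio j))
    · filter_upwards [self_mem_nhdsWithin] with u hu
      exact mul_lt_mul_of_pos_left hu (Φ.ratio_pos j)
  have h3 : renewalError Φ F y + renewalGap Φ F y = boxCount F y + boxGap F y -
      ∑ j, (boxCount F (Φ.ratio j * y) + boxGap F (Φ.ratio j * y)) := by
    simp only [renewalError, renewalGap, Finset.sum_add_distrib]
    ring
  rw [h3]
  exact h1.sub (tendsto_finsetSum _ h2)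

lemma rightLim_renewalError_sub (hc : IsCompact F) (hinf : F.Infinite) {y : ℝ} (hy : 0 < y) :
    Function.rightLim (renewalError Φ F) y - renewalError Φ F y = renewalGap Φ F y := by
  rw [rightLim_eq_of_tendsto (tendsto_renewalError_right hc hinf hy)]
  ring

lemma boxGap_of_lt (hc : IsCompact F) (hinf : F.Infinite) {y : ℝ} (hy : y < boxJump F 0) :
    boxGap F y = 0 := by
  refine boxGap_eq_zero hc hinf ?_
  rintro ⟨n, rfl⟩
  exact hy.not_ge ((boxJump_strictMono hc hinf).monotone (Nat.zero_le n))

lemma renewalGap_of_lt (hc : IsCompact F) (hinf : F.Infinite) {y : ℝ} (hy : y < boxJump F 0) :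
    renewalGap Φ F y = 0 := by
  have h0 := (boxCount_boxJump hc hinf 0).1
  rw [renewalGap, boxGap_of_lt hc hinf hy, Finset.sum_eq_zero, sub_zero]
  intro j _
  refine boxGap_of_lt hc hinf ?_
  rcases le_total y 0 with h | h
  · exact (mul_nonpos_of_nonneg_of_nonpos (Φ.ratio_pos j).le h).trans_lt h0
  · exact (mul_le_of_le_one_left h (Φ.ratio_lt_one j).le).trans_lt hy

/-- Jumps of L are bounded above because L vanishes eventually. Below any bound there are finitely
many jumps of N_B(F, ·), hence of each N_B(F, r_j ·). -/
lemma finite_support_renewalGap (hc : IsCompact F) (hinf : F.Infinite) {X : ℝ}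
    (hX : ∀ x > X, renewalError Φ F x = 0) : (Function.support (renewalGap Φ F)).Finite := by
  set Y := max X (boxJump F 0)
  have hle : ∀ y, renewalGap Φ F y ≠ 0 → y ≤ Y := by
    intro y hy
    by_contra! hlt
    have hy0 : 0 < y := (boxCount_boxJump hc hinf 0).1.trans ((le_max_right _ _).trans_lt hlt)
    have hXy : X < y := (le_max_left _ _).trans_lt hlt
    have ht := tendsto_renewalError_right (Φ := Φ) hc hinf hy0
    have h0 : Tendsto (renewalError Φ F) (𝓝[>] y) (𝓝 0) := by
      refine tendsto_const_nhds.congr' ?_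
      filter_upwards [self_mem_nhdsWithin] with u hu
      exact (hX u (hXy.trans hu)).symm
    have := tendsto_nhds_unique ht h0
    rw [hX y hXy, zero_add] at this
    exact hy this
  have hfin := fun Z => finite_boxJump_le hc hinf Z
  refine ((hfin Y).union (Set.finite_iUnion fun j : Fin N =>
    (hfin (Φ.ratio j * Y)).image fun u => (Φ.ratio j)⁻¹ * u)).subset fun y hy => ?_
  have hyY := hle y hy
  by_contra hcon
  rw [Set.mem_union, not_or, Set.mem_iUnion, not_exists] at hcon
  apply hy
  rw [renewalGap, boxGap_eq_zero hc hinf fun h => hcon.1 ⟨h, hyY⟩, Finset.sum_eq_zero, sub_zero]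
  intro j _
  refine boxGap_eq_zero hc hinf fun h => hcon.2 j ⟨Φ.ratio j * y, ⟨h, ?_⟩, ?_⟩
  · exact mul_le_mul_of_nonneg_left hyY (Φ.ratio_pos j).le
  · exact inv_mul_cancel_left₀ (Φ.ratio_pos j).ne' y

lemma renewalError_boxJump_zero (hc : IsCompact F) (hinf : F.Infinite) :
    renewalError Φ F (boxJump F 0) = 1 - N := by
  have h0 := (boxCount_boxJump hc hinf 0).1
  rw [renewalError, boxCount_eq_one hc hinf h0 le_rfl, Finset.sum_congr rfl (g := fun _ => (1 : ℝ))]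
  · simp
  · intro j _
    rw [boxCount_eq_one hc hinf (mul_pos (Φ.ratio_pos j) h0)
      (mul_le_of_le_one_left h0.le (Φ.ratio_lt_one j).le), Nat.cast_one]

/-- The first coefficient of h is a jump like the others: L(x_1) = 1 - N, because all counts are 1
up to x_1. No jump of L lies below x_1. -/
lemma numerator_eq_sum (hc : IsCompact F) (hinf : F.Infinite)
    (hfin : (Function.support (renewalGap Φ F)).Finite) (s : ℂ) :
    numerator Φ F s = ∑ y ∈ hfin.toFinset, (renewalGap Φ F y : ℂ) * (y : ℂ) ^ (-s) := by
  set x₀ := boxJump F 0 with hx₀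
  have h0 : 0 < x₀ := (boxCount_boxJump hc hinf 0).1
  set G : ℝ → ℂ := fun y => (renewalGap Φ F y : ℂ) * (y : ℂ) ^ (-s) with hG
  have hsupp : Function.support G ⊆ Function.support (renewalGap Φ F) := by
    intro y hy h
    apply hy
    simp [hG, h]
  have hfinG : (Function.support G).Finite := hfin.subset hsupp
  have h1 : ((N : ℂ) + ((Function.rightLim (renewalError Φ F) x₀ : ℝ) : ℂ) - 1) =
      (renewalGap Φ F x₀ : ℂ) := by
    rw [← rightLim_renewalError_sub hc hinf h0, hx₀, renewalError_boxJump_zero hc hinf]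
    push_cast
    ring
  have h2 : ∑ᶠ (y : ℝ) (_ : x₀ < y), ((Function.rightLim (renewalError Φ F) y -
      renewalError Φ F y : ℝ) : ℂ) * (y : ℂ) ^ (-s) = ∑ᶠ y ∈ Set.Ioi x₀, G y := by
    refine finsum_mem_congr rfl fun y hy => ?_
    rw [rightLim_renewalError_sub hc hinf (h0.trans hy)]
  rw [numerator, ← hx₀, h1, h2]
  change G x₀ + _ = _
  rw [← finsum_mem_insert' G (by simp) (hfinG.subset Set.inter_subset_right),
    ← finsum_eq_sum_of_support_subset (s := hfin.toFinset) G (by simpa using hsupp),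
    ← finsum_mem_univ G]
  refine finsum_mem_inter_support_eq' G _ _ fun y hy => ?_
  simp only [Set.mem_univ, iff_true, Set.mem_insert_iff, Set.mem_Ioi]
  by_contra hcon
  push Not at hcon
  exact hsupp hy (renewalGap_of_lt hc hinf (lt_of_le_of_ne hcon.2 hcon.1))

lemma ofReal_mul_cpow_neg {r y : ℝ} (hr : 0 < r) (hy : 0 < y) (s : ℂ) :
    (r : ℂ) ^ s * ((r * y : ℝ) : ℂ) ^ (-s) = (y : ℂ) ^ (-s) := by
  have hr' : (r : ℂ) ≠ 0 := Complex.ofReal_ne_zero.2 hr.ne'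
  rw [Complex.ofReal_mul, Complex.mul_cpow_ofReal_nonneg hr.le hy.le, ← mul_assoc,
    ← Complex.cpow_add _ _ hr']
  simp

/-- The closed form of the box-counting zeta function in the half plane of convergence. -/
lemma boxZeta_mul_eq (hc : IsCompact F) (hinf : F.Infinite)
    (hfin : (Function.support (renewalGap Φ F)).Finite) {s : ℂ}
    (hs : Summable fun n => (boxMult F n : ℝ) * boxLength F n ^ s.re) :
    (boxZeta F s - (boxJump F 0 : ℂ) ^ (-s)) * (1 - ∑ j, (Φ.ratio j : ℂ) ^ s) =
      numerator Φ F s := by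
  have hZ := hasSum_boxGap hc hinf hs
  set Z := boxZeta F s - (boxJump F 0 : ℂ) ^ (-s)
  have hj : ∀ j ∈ Finset.univ, HasSum (fun y : ℝ => (boxGap F (Φ.ratio j * y) : ℂ) *
      (y : ℂ) ^ (-s)) ((Φ.ratio j : ℂ) ^ s * Z) := by
    intro j _
    -- The substitution y ↦ r_j y in the sum for Z: the gaps of N_B(F, r_j ·) contribute r_j^s Z.
    have h1 := ((Equiv.mulLeft₀ (Φ.ratio j) (Φ.ratio_pos j).ne').hasSum_iff.2 hZ).mul_left
      ((Φ.ratio j : ℂ) ^ s)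
    suffices h2 : ∀ y : ℝ, (boxGap F (Φ.ratio j * y) : ℂ) * (y : ℂ) ^ (-s) =
        (Φ.ratio j : ℂ) ^ s * (boxGap F (Φ.ratio j * y) * ((Φ.ratio j * y : ℝ) : ℂ) ^ (-s)) by
      rw [funext h2]
      exact h1
    intro y
    rcases le_or_gt y 0 with hy | hy
    · rw [boxGap_of_nonpos (mul_nonpos_of_nonneg_of_nonpos (Φ.ratio_pos j).le hy)]
      simp
    · rw [← ofReal_mul_cpow_neg (Φ.ratio_pos j) hy s]
      ring
  have h1 := hZ.sub (hasSum_sum hj)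
  have h2 : HasSum (fun y : ℝ => (renewalGap Φ F y : ℂ) * (y : ℂ) ^ (-s))
      (numerator Φ F s) := by
    rw [numerator_eq_sum hc hinf hfin]
    refine hasSum_sum_of_ne_finset_zero fun y hy => ?_
    have : renewalGap Φ F y = 0 := by simpa using hy
    simp [this]
  rw [← Finset.sum_mul] at h1
  have h3 : (fun y : ℝ => (boxGap F y : ℂ) * (y : ℂ) ^ (-s) -
      ∑ j, (boxGap F (Φ.ratio j * y) : ℂ) * (y : ℂ) ^ (-s)) =
      fun y : ℝ => (renewalGap Φ F y : ℂ) * (y : ℂ) ^ (-s) := by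
    funext y
    rw [renewalGap, ← Finset.sum_mul]
    push_cast
    ring
  rw [h3] at h1
  rw [← h1.unique h2]
  ring

lemma differentiable_numerator (hc : IsCompact F) (hinf : F.Infinite)
    (hfin : (Function.support (renewalGap Φ F)).Finite) : Differentiable ℂ (numerator Φ F) := by
  rw [funext (numerator_eq_sum hc hinf hfin)]
  refine Differentiable.fun_sum fun y hy => ?_
  have hy0 : 0 < y := by
    by_contra! hle
    rw [Set.Finite.mem_toFinset] at hy
    exact hy (renewalGap_of_lt hc hinf (hle.trans_lt (boxCount_boxJump hc hinf 0).1))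
  intro s
  exact (differentiableAt_id.neg.const_cpow (Or.inl (Complex.ofReal_ne_zero.2 hy0.ne'))).const_mul _

/-! ### Disjoint systems -/

lemma IsDeltaDisjoint.le_dist {δ : ℝ} (h : IsDeltaDisjoint Φ F δ) {j k : Fin N} (hjk : j ≠ k)
    {p q : EuclideanSpace ℝ (Fin m)} (hp : p ∈ Φ.map j '' F) (hq : q ∈ Φ.map k '' F) :
    δ ≤ dist p q :=
  h.2.1.2 fun _ hα => (hα j k hjk p hp q hq).le

lemma map_injective (Φ : SelfSimilarSystem m N) (j : Fin N) : Function.Injective (Φ.map j) := by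
  intro p q h
  have := Φ.dist_map j p q
  rw [h, dist_self, zero_eq_mul] at this
  exact dist_eq_zero.1 (this.resolve_left (Φ.ratio_pos j).ne')

lemma IsAttractor.image_subset (hF : IsAttractor Φ F) (k : Fin N) : Φ.map k '' F ⊆ F := by
  conv_rhs => rw [← hF.2.2]
  exact Set.subset_iUnion (fun j => Φ.map j '' F) k

/-- On a finite F the injective map φ_i would be onto F, so φ_i(F) would contain every other piece,
against disjointness. -/
lemma infinite_attractor {δ : ℝ} (hF : IsAttractor Φ F) (hδ : IsDeltaDisjoint Φ F δ) :
    F.Infinite := by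
  intro hfin
  have h2 := Φ.two_le
  set i : Fin N := ⟨0, by omega⟩
  set j : Fin N := ⟨1, by omega⟩
  have hsub := hF.image_subset
  have heq : Φ.map i '' F = F := Set.eq_of_subset_of_ncard_le (hsub i)
    (Set.ncard_image_of_injective F (map_injective Φ i)).ge hfin
  obtain ⟨p, hp⟩ := hF.1.image (Φ.map j)
  exact Set.disjoint_left.1 (hδ.1 i j (by simp [i, j])) (heq.ge (hsub j hp)) hp

/-- Since φ_j scales distances by r_j, packings of φ_j(F) of radius x⁻¹ correspond to packings of F
of radius (r_j x)⁻¹. The condition on x says 2x⁻¹ < δ, so packings of different pieces can be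
united. -/
lemma renewal_equation {δ : ℝ} (hF : IsAttractor Φ F) (hδ : IsDeltaDisjoint Φ F δ) {x : ℝ}
    (hx : 2 / δ < x) : boxCount F x = ∑ j, boxCount F (Φ.ratio j * x) := by
  classical
  have hδ0 := hδ.2.2
  have hx0 : 0 < x := (by positivity : 0 < 2 / δ).trans hx
  have hxδ : x⁻¹ + x⁻¹ < δ := by
    rw [div_lt_iff₀ hδ0] at hx
    rw [← two_mul, ← div_eq_mul_inv, div_lt_iff₀ hx0]
    linarith
  have hrx : ∀ j, 0 < Φ.ratio j * x := fun j => mul_pos (Φ.ratio_pos j) hx0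
  have hsep : ∀ j p q, (Φ.ratio j * x)⁻¹ + (Φ.ratio j * x)⁻¹ < dist p q ↔
      x⁻¹ + x⁻¹ < dist (Φ.map j p) (Φ.map j q) := by
    intro j p q
    rw [Φ.dist_map, mul_inv, ← mul_add, inv_mul_lt_iff₀ (Φ.ratio_pos j)]
  have hsub := hF.image_subset
  apply le_antisymm
  -- Splitting a packing of F among the pieces; the separation plays no role in this direction.
  · obtain ⟨t, ht, hcard⟩ := exists_packing_card_eq hF.2.1 hx0
    rw [← hcard]
    have hcov : t ⊆ Finset.univ.biUnion fun j =>
        (t.preimage (Φ.map j) (map_injective Φ j).injOn |>.filter (· ∈ F)).image (Φ.map j) := by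
      intro p hp
      have hpF := ht.1 hp
      rw [← hF.2.2] at hpF
      obtain ⟨j, q, hq, rfl⟩ := Set.mem_iUnion.1 hpF
      simp only [Finset.mem_biUnion, Finset.mem_image, Finset.mem_filter, Finset.mem_preimage]
      exact ⟨j, Finset.mem_univ j, q, ⟨hp, hq⟩, rfl⟩
    refine (Finset.card_le_card hcov).trans (Finset.card_biUnion_le.trans ?_)
    refine Finset.sum_le_sum fun j _ => Finset.card_image_le.trans ?_
    refine card_le_boxCount hF.2.1 (hrx j) ⟨fun q hq => ?_, fun p hp q hq hpq => ?_⟩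
    · exact (Finset.mem_filter.1 hq).2
    · rw [hsep]
      rw [Finset.mem_filter, Finset.mem_preimage] at hp hq
      exact ht.2 _ hp.1 _ hq.1 fun h => hpq (map_injective Φ j h)
  · choose t ht hcard using fun j => exists_packing_card_eq hF.2.1 (hrx j)
    have hmem : ∀ j, ∀ p ∈ (t j).image (Φ.map j), p ∈ Φ.map j '' F := by
      intro j p hp
      obtain ⟨q, hq, rfl⟩ := Finset.mem_image.1 hp
      exact ⟨q, (ht j).1 hq, rfl⟩
    have hdisj : ∀ j ∈ Finset.univ, ∀ k ∈ Finset.univ, j ≠ k →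
        Disjoint ((t j).image (Φ.map j)) ((t k).image (Φ.map k)) := by
      intro j _ k _ hjk
      rw [Finset.disjoint_left]
      exact fun p hp hp' => Set.disjoint_left.1 (hδ.1 j k hjk) (hmem j p hp) (hmem k p hp')
    calc ∑ j, boxCount F (Φ.ratio j * x) = ∑ j, ((t j).image (Φ.map j)).card := by
          refine Finset.sum_congr rfl fun j _ => ?_
          rw [Finset.card_image_of_injective _ (map_injective Φ j), hcard]
      _ = (Finset.univ.biUnion fun j => (t j).image (Φ.map j)).card :=
          (Finset.card_biUnion hdisj).symm
      _ ≤ boxCount F x := by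
          refine card_le_boxCount hF.2.1 hx0 ⟨fun p hp => ?_, fun p hp q hq hpq => ?_⟩
          · obtain ⟨j, _, hj⟩ := Finset.mem_biUnion.1 hp
            exact hsub j (hmem j p hj)
          · obtain ⟨j, _, hj⟩ := Finset.mem_biUnion.1 hp
            obtain ⟨k, _, hk⟩ := Finset.mem_biUnion.1 hq
            by_cases hjk : j = k
            · subst hjk
              obtain ⟨p', hp', rfl⟩ := Finset.mem_image.1 hj
              obtain ⟨q', hq', rfl⟩ := Finset.mem_image.1 hk
              rw [← hsep]
              exact (ht j).2 p' hp' q' hq' fun h => hpq (h ▸ rfl)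
            · exact hxδ.trans_le (hδ.le_dist hjk (hmem j p hj) (hmem k q hk))

lemma renewalError_eq_zero {δ : ℝ} (hF : IsAttractor Φ F) (hδ : IsDeltaDisjoint Φ F δ) {x : ℝ}
    (hx : 2 / δ < x) : renewalError Φ F x = 0 := by
  rw [renewalError, renewal_equation hF hδ hx]
  push_cast
  ring

end SelfSimilar

namespace SelfSimilar
variable {m N : ℕ}

/-! ### Convergence of the box-counting zeta function -/

variable {Φ : SelfSimilarSystem m N} {F : Set (EuclideanSpace ℝ (Fin m))}

lemma exists_ratio_bounds (Φ : SelfSimilarSystem m N) :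
    ∃ ρ R : ℝ, 0 < ρ ∧ 0 < R ∧ R < 1 ∧ ∀ j, ρ ≤ Φ.ratio j ∧ Φ.ratio j ≤ R := by
  have h2 := Φ.two_le
  have : Nonempty (Fin N) := ⟨⟨0, by omega⟩⟩
  obtain ⟨i, hi⟩ := Finite.exists_min Φ.ratio
  obtain ⟨j, hj⟩ := Finite.exists_max Φ.ratio
  exact ⟨_, _, Φ.ratio_pos i, Φ.ratio_pos j, Φ.ratio_lt_one j, fun k => ⟨hi k, hj k⟩⟩

/-- The box-counting function of a disjoint self-similar set grows at most polynomially. -/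
lemma exists_boxCount_le_pow {δ : ℝ} (hF : IsAttractor Φ F) (hδ : IsDeltaDisjoint Φ F δ) :
    ∃ C > 0, ∃ X > 0, ∃ D : ℕ, ∀ x, X ≤ x → (boxCount F x : ℝ) ≤ C * x ^ D := by
  obtain ⟨ρ, R, hρ, hR0, hR1, hρR⟩ := exists_ratio_bounds Φ
  have hδ0 := hδ.2.2
  set X := 2 / δ + 1 with hX
  have hX0 : 0 < X := by positivity
  -- With this exponent a bound C x^D on every N_B(F, r_j x) passes through the renewal equation to
  -- N_B(F, x).
  obtain ⟨D, hD⟩ : ∃ D : ℕ, N * R ^ D < 1 := by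
    have h := (tendsto_pow_atTop_nhds_zero_of_lt_one hR0.le hR1).const_mul (N : ℝ)
    rw [mul_zero] at h
    exact (h.eventually (gt_mem_nhds one_pos)).exists
  set C : ℝ := (boxCount F X + 1) / (ρ * X) ^ D with hC
  have hC0 : 0 < C := by positivity
  have hbase : ∀ x, ρ * X ≤ x → x ≤ X → (boxCount F x : ℝ) ≤ C * x ^ D := by
    intro x h1 h2
    have hx0 : 0 < x := (by positivity : 0 < ρ * X).trans_le h1
    calc (boxCount F x : ℝ) ≤ boxCount F X := by exact_mod_cast boxCount_mono hF.2.1 hx0 h2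
      _ ≤ boxCount F X + 1 := by linarith
      _ = C * (ρ * X) ^ D := by rw [hC, div_mul_cancel₀ _ (by positivity)]
      _ ≤ C * x ^ D := by gcongr
  -- Induction on the number of contractions by R that bring x below X. A step starts above X and so
  -- lands above ρX, which is why the base range reaches down to ρX.
  have key : ∀ k : ℕ, ∀ x, ρ * X ≤ x → x * R ^ k ≤ X → (boxCount F x : ℝ) ≤ C * x ^ D := by
    intro k
    induction k with
    | zero => exact fun x h1 h2 => hbase x h1 (by simpa using h2)
    | succ k ih =>
      intro x h1 h2
      rcases le_or_gt x X with h | h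
      · exact hbase x h1 h
      have hx0 : 0 < x := hX0.trans h
      rw [renewal_equation hF hδ (by linarith)]
      push_cast
      calc ∑ j, (boxCount F (Φ.ratio j * x) : ℝ) ≤ ∑ _j : Fin N, C * x ^ D * R ^ D := by
            refine Finset.sum_le_sum fun j _ => (ih _ ?_ ?_).trans ?_
            · exact mul_le_mul (hρR j).1 h.le hX0.le (Φ.ratio_pos j).le
            · refine le_trans ?_ h2
              rw [pow_succ]
              have := mul_le_mul_of_nonneg_right (hρR j).2 (mul_pos hx0 (pow_pos hR0 k)).le
              linarith
            · rw [mul_pow, mul_assoc, mul_comm (x ^ D)]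
              have := pow_le_pow_left₀ (Φ.ratio_pos j).le (hρR j).2 D
              gcongr
        _ = C * x ^ D * (N * R ^ D) := by
            simp
            ring
        _ ≤ C * x ^ D := mul_le_of_le_one_right (by positivity) hD.le
  refine ⟨C, hC0, ρ * X, by positivity, D, fun x hx => ?_⟩
  have h := (tendsto_pow_atTop_nhds_zero_of_lt_one hR0.le hR1).const_mul x
  rw [mul_zero] at h
  obtain ⟨k, hk⟩ := (h.eventually (gt_mem_nhds hX0)).exists
  exact key k x hx hk.le

lemma boxValue_succ_le (hc : IsCompact F) (hinf : F.Infinite) {n : ℕ} {x : ℝ}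
    (h : boxJump F n < x) : boxValue F (n + 1) ≤ boxCount F x := by
  obtain ⟨p, -, h4⟩ := boxCount_boxJump hc hinf n
  have hx := p.trans h
  obtain ⟨k, hk⟩ := exists_boxValue_eq hx hc hinf
  rw [← not_le, h4 x hx, ← hk, not_le] at h
  rw [← hk]
  exact (boxValue_strictMono hc hinf).monotone ((boxValue_strictMono hc hinf).lt_iff_lt.1 h)

/-- The exponent 3D works: m_n is O(x_n^D) and n ≤ M_n is O(x_n^D), so m_n x_n^{-3D} is O(n^{-2}).
The set whose infimum is `boxAbscissa` is therefore nonempty. -/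
lemma exists_summable {δ : ℝ} (hF : IsAttractor Φ F) (hδ : IsDeltaDisjoint Φ F δ) :
    ∃ α : ℝ, Summable fun n => (boxMult F n : ℝ) * boxLength F n ^ α := by
  have hc := hF.2.1
  have hinf := infinite_attractor hF hδ
  obtain ⟨C, hC, X, hX, D, hD⟩ := exists_boxCount_le_pow hF hδ
  refine ⟨(3 * D : ℕ), ?_⟩
  have hsum : Summable fun n : ℕ => C ^ 3 * 2 ^ D * ((n : ℝ) ^ 2)⁻¹ :=
    (Real.summable_nat_pow_inv.2 one_lt_two).mul_left _
  refine Summable.of_norm_bounded_eventually_nat hsum ?_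
  filter_upwards [(tendsto_boxJump hc hinf).eventually_ge_atTop X, eventually_ge_atTop 1]
    with n hn hn1
  obtain ⟨hx, hxv, -⟩ := boxCount_boxJump hc hinf n
  set x := boxJump F n with hxdef
  have hm : (boxMult F n : ℝ) ≤ C * (2 * x) ^ D := by
    calc (boxMult F n : ℝ) ≤ boxValue F (n + 1) := by
          rw [boxMult, if_neg (by omega)]
          exact_mod_cast Nat.sub_le _ _
      _ ≤ boxCount F (2 * x) := by
          exact_mod_cast boxValue_succ_le hc hinf (by linarith)
      _ ≤ _ := hD _ (by linarith)
  have hn' : (n : ℝ) ≤ C * x ^ D := by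
    calc (n : ℝ) ≤ boxValue F n := by exact_mod_cast (boxValue_strictMono hc hinf).id_le n
      _ = boxCount F x := by rw [hxv]
      _ ≤ _ := hD _ hn
  have hn0 : (0 : ℝ) < n := by exact_mod_cast hn1
  have hinv : (x ^ D)⁻¹ ≤ C * (n : ℝ)⁻¹ := by
    rw [← div_eq_mul_inv, le_div_iff₀ hn0, inv_mul_le_iff₀ (by positivity)]
    linarith
  rw [Real.rpow_natCast, boxLength, ← hxdef, Real.norm_of_nonneg (by positivity)]
  calc (boxMult F n : ℝ) * x⁻¹ ^ (3 * D) ≤ C * (2 * x) ^ D * x⁻¹ ^ (3 * D) := by gcongr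
    _ = C * 2 ^ D * (x ^ D)⁻¹ ^ 2 := by
        rw [mul_pow, show x⁻¹ ^ (3 * D) = (x ^ D)⁻¹ ^ 3 by
          rw [← inv_pow, ← pow_mul, mul_comm]]
        have : x ^ D ≠ 0 := by positivity
        field_simp
    _ ≤ C * 2 ^ D * (C * (n : ℝ)⁻¹) ^ 2 := by gcongr
    _ = C ^ 3 * 2 ^ D * ((n : ℝ) ^ 2)⁻¹ := by ring

lemma summable_of_boxAbscissa_lt {δ : ℝ} (hF : IsAttractor Φ F) (hδ : IsDeltaDisjoint Φ F δ) {σ : ℝ}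
    (hσ : boxAbscissa F < σ) : Summable fun n => (boxMult F n : ℝ) * boxLength F n ^ σ := by
  have hc := hF.2.1
  have hinf := infinite_attractor hF hδ
  obtain ⟨α, hα, hασ⟩ := exists_lt_of_csInf_lt (exists_summable hF hδ) hσ
  refine Summable.of_norm_bounded_eventually_nat hα ?_
  filter_upwards [(tendsto_boxJump hc hinf).eventually_ge_atTop 1] with n hn
  have hl : 0 < boxLength F n := inv_pos.2 (boxCount_boxJump hc hinf n).1
  -- For lengths at most 1, raising the exponent decreases the terms.
  have hl1 : boxLength F n ≤ 1 := inv_le_one_of_one_le₀ hn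
  rw [Real.norm_of_nonneg (by positivity)]
  exact mul_le_mul_of_nonneg_left (Real.rpow_le_rpow_of_exponent_ge hl hl1 hασ.le) (by positivity)

end SelfSimilar

namespace SelfSimilar

/-! ## Rouché's theorem on rectangles -/

/-- The integral of `f` along the boundary of the rectangle `[a, b] × [c, d]`. -/
def rectIntegral (f : ℂ → ℂ) (a b c d : ℝ) : ℂ :=
  (∫ x : ℝ in a..b, f (x + c * Complex.I)) - (∫ x : ℝ in a..b, f (x + d * Complex.I)) +
    Complex.I • (∫ y : ℝ in c..d, f (b + y * Complex.I)) -
    Complex.I • (∫ y : ℝ in c..d, f (a + y * Complex.I))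

def closedRect (a b c d : ℝ) : Set ℂ := Set.Icc a b ×ℂ Set.Icc c d

def openRect (a b c d : ℝ) : Set ℂ := Set.Ioo a b ×ℂ Set.Ioo c d

def rectBoundary (a b c d : ℝ) : Set ℂ := closedRect a b c d \ openRect a b c d

variable {a b c d : ℝ}

lemma openRect_subset_closedRect : openRect a b c d ⊆ closedRect a b c d := fun _ h =>
  ⟨Set.Ioo_subset_Icc_self h.1, Set.Ioo_subset_Icc_self h.2⟩

lemma isCompact_closedRect : IsCompact (closedRect a b c d) :=
  isCompact_Icc.reProdIm isCompact_Icc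

lemma horizontal_mem_rectBoundary (hcd : c ≤ d) {x : ℝ} (hx : x ∈ Set.Icc a b) :
    (x + c * Complex.I : ℂ) ∈ rectBoundary a b c d ∧
      (x + d * Complex.I : ℂ) ∈ rectBoundary a b c d := by
  simp [rectBoundary, closedRect, openRect, Complex.mem_reProdIm, hx.1, hx.2, hcd]

lemma vertical_mem_rectBoundary (hab : a ≤ b) {y : ℝ} (hy : y ∈ Set.Icc c d) :
    (a + y * Complex.I : ℂ) ∈ rectBoundary a b c d ∧
      (b + y * Complex.I : ℂ) ∈ rectBoundary a b c d := by
  simp [rectBoundary, closedRect, openRect, Complex.mem_reProdIm, hy.1, hy.2, hab]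

lemma intervalIntegrable_horizontal {f : ℂ → ℂ} {s : Set ℂ} (hf : ContinuousOn f s) {e : ℝ}
    (hab : a ≤ b) (h : ∀ x ∈ Set.Icc a b, (x + e * Complex.I : ℂ) ∈ s) :
    IntervalIntegrable (fun x : ℝ => f (x + e * Complex.I)) MeasureTheory.volume a b := by
  apply ContinuousOn.intervalIntegrable
  rw [Set.uIcc_of_le hab]
  exact hf.comp (by fun_prop) h

lemma intervalIntegrable_vertical {f : ℂ → ℂ} {s : Set ℂ} (hf : ContinuousOn f s) {e : ℝ}
    (hcd : c ≤ d) (h : ∀ y ∈ Set.Icc c d, (e + y * Complex.I : ℂ) ∈ s) :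
    IntervalIntegrable (fun y : ℝ => f (e + y * Complex.I)) MeasureTheory.volume c d := by
  apply ContinuousOn.intervalIntegrable
  rw [Set.uIcc_of_le hcd]
  exact hf.comp (by fun_prop) h

lemma integral_horizontal_eq_sub {F f : ℂ → ℂ} {e : ℝ} (hab : a ≤ b)
    (hF : ∀ x ∈ Set.Icc a b, HasDerivAt F (f (x + e * Complex.I)) (x + e * Complex.I))
    (hf : IntervalIntegrable (fun x : ℝ => f (x + e * Complex.I)) MeasureTheory.volume a b) :
    ∫ x : ℝ in a..b, f (x + e * Complex.I) = F (b + e * Complex.I) - F (a + e * Complex.I) := by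
  refine intervalIntegral.integral_eq_sub_of_hasDerivAt (f := fun x : ℝ => F (x + e * Complex.I))
    (fun x hx => ?_) hf
  rw [Set.uIcc_of_le hab] at hx
  have h := (hF x hx).comp_add_const (x : ℂ) (e * Complex.I)
  exact h.comp_ofReal

lemma integral_vertical_eq_sub {F f : ℂ → ℂ} {e : ℝ} (hcd : c ≤ d)
    (hF : ∀ y ∈ Set.Icc c d, HasDerivAt F (f (e + y * Complex.I)) (e + y * Complex.I))
    (hf : IntervalIntegrable (fun y : ℝ => f (e + y * Complex.I)) MeasureTheory.volume c d) :
    Complex.I • ∫ y : ℝ in c..d, f (e + y * Complex.I) =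
      F (e + d * Complex.I) - F (e + c * Complex.I) := by
  rw [← intervalIntegral.integral_smul]
  refine intervalIntegral.integral_eq_sub_of_hasDerivAt (f := fun y : ℝ => F (e + y * Complex.I))
    (fun y hy => ?_) (hf.smul (r := Complex.I))
  rw [Set.uIcc_of_le hcd] at hy
  have h1 : HasDerivAt (fun z : ℂ => (e + z * Complex.I : ℂ)) Complex.I (y : ℂ) := by
    simpa using ((hasDerivAt_id (y : ℂ)).mul_const Complex.I).const_add (e : ℂ)
  have h := HasDerivAt.comp (y : ℂ) (hF y hy) h1
  have h2 := h.comp_ofReal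
  simpa [mul_comm] using h2

/-- The four sides telescope; a primitive is needed only at the points of the boundary. -/
lemma rectIntegral_eq_zero_of_hasDerivAt (hab : a ≤ b) (hcd : c ≤ d) {F f : ℂ → ℂ}
    (hF : ∀ z ∈ rectBoundary a b c d, HasDerivAt F (f z) z)
    (hf : ContinuousOn f (rectBoundary a b c d)) : rectIntegral f a b c d = 0 := by
  have H := fun x hx => horizontal_mem_rectBoundary (a := a) (b := b) hcd (x := x) hx
  have V := fun y hy => vertical_mem_rectBoundary (c := c) (d := d) hab (y := y) hy
  rw [rectIntegral,
    integral_horizontal_eq_sub hab (fun x hx => hF _ (H x hx).1)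
      (intervalIntegrable_horizontal hf hab fun x hx => (H x hx).1),
    integral_horizontal_eq_sub hab (fun x hx => hF _ (H x hx).2)
      (intervalIntegrable_horizontal hf hab fun x hx => (H x hx).2),
    integral_vertical_eq_sub hcd (fun x hx => hF _ (V x hx).1)
      (intervalIntegrable_vertical hf hcd fun x hx => (V x hx).1),
    integral_vertical_eq_sub hcd (fun x hx => hF _ (V x hx).2)
      (intervalIntegrable_vertical hf hcd fun x hx => (V x hx).2)]
  ring

lemma rectIntegral_add (hab : a ≤ b) (hcd : c ≤ d) {f g : ℂ → ℂ}
    (hf : ContinuousOn f (rectBoundary a b c d)) (hg : ContinuousOn g (rectBoundary a b c d)) :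
    rectIntegral (fun z => f z + g z) a b c d =
      rectIntegral f a b c d + rectIntegral g a b c d := by
  have H := fun x hx => horizontal_mem_rectBoundary (a := a) (b := b) hcd (x := x) hx
  have V := fun y hy => vertical_mem_rectBoundary (c := c) (d := d) hab (y := y) hy
  simp only [rectIntegral]
  rw [intervalIntegral.integral_add
      (intervalIntegrable_horizontal hf hab fun x hx => (H x hx).1)
      (intervalIntegrable_horizontal hg hab fun x hx => (H x hx).1),
    intervalIntegral.integral_add
      (intervalIntegrable_horizontal hf hab fun x hx => (H x hx).2)
      (intervalIntegrable_horizontal hg hab fun x hx => (H x hx).2),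
    intervalIntegral.integral_add
      (intervalIntegrable_vertical hf hcd fun x hx => (V x hx).1)
      (intervalIntegrable_vertical hg hcd fun x hx => (V x hx).1),
    intervalIntegral.integral_add
      (intervalIntegrable_vertical hf hcd fun x hx => (V x hx).2)
      (intervalIntegrable_vertical hg hcd fun x hx => (V x hx).2)]
  simp only [smul_eq_mul]
  ring

lemma rectIntegral_congr (hab : a ≤ b) (hcd : c ≤ d) {f g : ℂ → ℂ}
    (h : ∀ z ∈ rectBoundary a b c d, f z = g z) :
    rectIntegral f a b c d = rectIntegral g a b c d := by
  have H := fun x hx => horizontal_mem_rectBoundary (a := a) (b := b) hcd (x := x) hx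
  have V := fun y hy => vertical_mem_rectBoundary (c := c) (d := d) hab (y := y) hy
  rw [← Set.uIcc_of_le hab] at H
  rw [← Set.uIcc_of_le hcd] at V
  simp only [rectIntegral]
  rw [intervalIntegral.integral_congr fun x hx => h _ (H x hx).1,
    intervalIntegral.integral_congr fun x hx => h _ (H x hx).2,
    intervalIntegral.integral_congr fun x hx => h _ (V x hx).1,
    intervalIntegral.integral_congr fun x hx => h _ (V x hx).2]

/-- The logarithmic derivative of a function with values in the slit plane integrates to zero. -/
lemma rectIntegral_logDeriv_eq_zero (hab : a ≤ b) (hcd : c ≤ d) {φ : ℂ → ℂ}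
    (hφ : ∀ z ∈ rectBoundary a b c d, AnalyticAt ℂ φ z)
    (hs : ∀ z ∈ rectBoundary a b c d, φ z ∈ Complex.slitPlane) :
    rectIntegral (logDeriv φ) a b c d = 0 := by
  refine rectIntegral_eq_zero_of_hasDerivAt hab hcd (F := fun z => Complex.log (φ z))
    (fun z hz => ?_) fun z hz => ?_
  · exact (hφ z hz).differentiableAt.hasDerivAt.clog (hs z hz)
  · have h0 : φ z ≠ 0 := Complex.slitPlane_ne_zero (hs z hz)
    exact ((hφ z hz).deriv.div (hφ z hz) h0).continuousAt.continuousWithinAt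

lemma continuousOn_logDeriv {f : ℂ → ℂ} (hf : Differentiable ℂ f) {s : Set ℂ}
    (h0 : ∀ z ∈ s, f z ≠ 0) : ContinuousOn (logDeriv f) s := fun z hz =>
  ((hf.analyticAt z).deriv.div (hf.analyticAt z) (h0 z hz)).continuousAt.continuousWithinAt

lemma rectIntegral_logDeriv_eq_zero_of_ne_zero (hab : a ≤ b) (hcd : c ≤ d) {u : ℂ → ℂ}
    (hu : Differentiable ℂ u) (h0 : ∀ z ∈ closedRect a b c d, u z ≠ 0) :
    rectIntegral (logDeriv u) a b c d = 0 := by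
  have h := Complex.integral_boundary_rect_eq_zero_of_differentiableOn (logDeriv u)
    (a + c * Complex.I) (b + d * Complex.I) (fun z hz => by
      have hz' : z ∈ closedRect a b c d := by
        simpa [Set.uIcc_of_le hab, Set.uIcc_of_le hcd, closedRect] using hz
      exact ((hu.analyticAt z).deriv.div (hu.analyticAt z)
        (h0 z hz')).differentiableAt.differentiableWithinAt)
  simpa [rectIntegral] using h

lemma integral_pos_of_pos {u v : ℝ} (huv : u < v) {g : ℝ → ℝ} (hg : ContinuousOn g (Set.Icc u v))
    (h : ∀ x ∈ Set.Icc u v, 0 < g x) : 0 < ∫ x in u..v, g x := by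
  refine intervalIntegral.intervalIntegral_pos_of_pos_on ?_
    (fun x hx => h x (Set.Ioo_subset_Icc_self hx)) huv
  apply ContinuousOn.intervalIntegrable
  rwa [Set.uIcc_of_le huv.le]

lemma im_integral {u v : ℝ} {g : ℝ → ℂ}
    (h : IntervalIntegrable g MeasureTheory.volume u v) :
    (∫ x in u..v, g x).im = ∫ x in u..v, (g x).im :=
  (Complex.imCLM.intervalIntegral_comp_comm h).symm

lemma re_integral {u v : ℝ} {g : ℝ → ℂ}
    (h : IntervalIntegrable g MeasureTheory.volume u v) :
    (∫ x in u..v, g x).re = ∫ x in u..v, (g x).re :=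
  (Complex.reCLM.intervalIntegral_comp_comm h).symm

lemma ne_of_mem_rectBoundary {α z : ℂ} (hα : α ∈ openRect a b c d)
    (hz : z ∈ rectBoundary a b c d) : z - α ≠ 0 := by
  rw [sub_ne_zero]
  rintro rfl
  exact hz.2 hα

/-- The value 2πi is not needed, only that it can be cancelled. Each of the four sides contributes a
positive amount to the imaginary part. -/
lemma rectIntegral_sub_inv_ne_zero {α : ℂ} (hα : α ∈ openRect a b c d) :
    rectIntegral (fun z => (z - α)⁻¹) a b c d ≠ 0 := by
  obtain ⟨⟨h1, h2⟩, h3, h4⟩ := hα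
  have hα : α ∈ openRect a b c d := ⟨⟨h1, h2⟩, h3, h4⟩
  have hab : a < b := h1.trans h2
  have hcd : c < d := h3.trans h4
  have H := fun x hx => horizontal_mem_rectBoundary (a := a) (b := b) hcd.le (x := x) hx
  have V := fun y hy => vertical_mem_rectBoundary (c := c) (d := d) hab.le (y := y) hy
  have hf : ContinuousOn (fun z => (z - α)⁻¹) (rectBoundary a b c d) :=
    (continuousOn_id.sub continuousOn_const).inv₀ fun z hz => ne_of_mem_rectBoundary hα hz
  have i1 := intervalIntegrable_horizontal hf hab.le fun x hx => (H x hx).1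
  have i2 := intervalIntegrable_horizontal hf hab.le fun x hx => (H x hx).2
  have i3 := intervalIntegrable_vertical hf hcd.le fun x hx => (V x hx).1
  have i4 := intervalIntegrable_vertical hf hcd.le fun x hx => (V x hx).2
  have n : ∀ z ∈ rectBoundary a b c d, 0 < Complex.normSq (z - α) := fun z hz =>
    Complex.normSq_pos.2 (ne_of_mem_rectBoundary hα hz)
  have p1 : 0 < ∫ x : ℝ in a..b, ((x + c * Complex.I - α)⁻¹ : ℂ).im := by
    refine integral_pos_of_pos hab ?_ fun x hx => ?_
    · exact Complex.continuous_im.comp_continuousOn (hf.comp (by fun_prop) fun x hx => (H x hx).1)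
    · rw [Complex.inv_im]
      exact div_pos (by simp; linarith) (n _ (H x hx).1)
  have p2 : 0 < ∫ x : ℝ in a..b, -((x + d * Complex.I - α)⁻¹ : ℂ).im := by
    refine integral_pos_of_pos hab ?_ fun x hx => ?_
    · exact (Complex.continuous_im.comp_continuousOn
        (hf.comp (by fun_prop) fun x hx => (H x hx).2)).neg
    · rw [Complex.inv_im, ← neg_div]
      exact div_pos (by simp; linarith) (n _ (H x hx).2)
  have p3 : 0 < ∫ y : ℝ in c..d, -((a + y * Complex.I - α)⁻¹ : ℂ).re := by
    refine integral_pos_of_pos hcd ?_ fun x hx => ?_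
    · exact (Complex.continuous_re.comp_continuousOn
        (hf.comp (by fun_prop) fun x hx => (V x hx).1)).neg
    · rw [Complex.inv_re, ← neg_div]
      exact div_pos (by simp; linarith) (n _ (V x hx).1)
  have p4 : 0 < ∫ y : ℝ in c..d, ((b + y * Complex.I - α)⁻¹ : ℂ).re := by
    refine integral_pos_of_pos hcd ?_ fun x hx => ?_
    · exact Complex.continuous_re.comp_continuousOn (hf.comp (by fun_prop) fun x hx => (V x hx).2)
    · rw [Complex.inv_re]
      exact div_pos (by simp; linarith) (n _ (V x hx).2)
  rw [intervalIntegral.integral_neg] at p2 p3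
  intro h
  have h' := congrArg Complex.im h
  simp only [rectIntegral, smul_eq_mul, Complex.sub_im, Complex.add_im, Complex.I_mul_im,
    im_integral i1, im_integral i2, re_integral i3, re_integral i4, Complex.zero_im] at h'
  linarith

/-- The quotient (z - α)/(z - β) is a nonpositive real only on the segment from α to β, which stays
inside the convex open rectangle. On the boundary it thus has a logarithm, whose derivative is the
difference of the two integrands. -/
lemma rectIntegral_sub_inv_eq {α β : ℂ} (hα : α ∈ openRect a b c d) (hβ : β ∈ openRect a b c d) :
    rectIntegral (fun z => (z - α)⁻¹) a b c d = rectIntegral (fun z => (z - β)⁻¹) a b c d := by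
  have hab : a < b := hα.1.1.trans hα.1.2
  have hcd : c < d := hα.2.1.trans hα.2.2
  have key : rectIntegral (logDeriv fun z => (z - α) / (z - β)) a b c d = 0 := by
    refine rectIntegral_logDeriv_eq_zero hab.le hcd.le (fun z hz => ?_) fun z hz => ?_
    · exact (analyticAt_id.sub analyticAt_const).div (analyticAt_id.sub analyticAt_const)
        (ne_of_mem_rectBoundary hβ hz)
    · by_contra hs
      rw [Complex.mem_slitPlane_iff_not_le_zero, not_not] at hs
      obtain ⟨t, ht⟩ : ∃ t : ℝ, (z - α) / (z - β) = -(t : ℂ) := by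
        refine ⟨-((z - α) / (z - β)).re, ?_⟩
        apply Complex.ext <;> simp [(Complex.le_def.1 hs).2]
      have ht0 : 0 ≤ t := by
        rw [ht] at hs
        have := (Complex.le_def.1 hs).1
        simpa using this
      rw [div_eq_iff (ne_of_mem_rectBoundary hβ hz)] at ht
      have hz' : z = (1 / (1 + t) : ℝ) • α + (t / (1 + t) : ℝ) • β := by
        have : (1 + t : ℂ) ≠ 0 := by
          exact_mod_cast (by positivity : (1 + t : ℝ) ≠ 0)
        simp only [Complex.real_smul]
        push_cast
        field_simp
        linear_combination ht
      have hconv : Convex ℝ (openRect a b c d) :=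
        ((convex_Ioo a b).linear_preimage Complex.reLm).inter
          ((convex_Ioo c d).linear_preimage Complex.imLm)
      exact hz.2 (hz' ▸ hconv hα hβ (by positivity) (by positivity) (by field_simp))
  have cα : ∀ γ ∈ openRect a b c d, ContinuousOn (fun z => (z - γ)⁻¹) (rectBoundary a b c d) :=
    fun γ hγ => (continuousOn_id.sub continuousOn_const).inv₀
      fun z hz => ne_of_mem_rectBoundary hγ hz
  rw [rectIntegral_congr hab.le hcd.le (g := fun z => (z - α)⁻¹ + -(z - β)⁻¹) fun z hz => ?_,
    rectIntegral_add hab.le hcd.le (g := fun z => -(z - β)⁻¹) (cα α hα) (cα β hβ).neg] at key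
  · have : rectIntegral (fun z => -(z - β)⁻¹) a b c d =
        - rectIntegral (fun z => (z - β)⁻¹) a b c d := by
      simp only [rectIntegral, intervalIntegral.integral_neg, smul_eq_mul]
      ring
    rw [this] at key
    linear_combination key
  · rw [logDeriv_div (f := fun z => z - α) (g := fun z => z - β) z
      (ne_of_mem_rectBoundary hα hz) (ne_of_mem_rectBoundary hβ hz)
      (by fun_prop) (by fun_prop)]
    simp [logDeriv_apply, sub_eq_add_neg]

lemma finite_zeros_inter_compact {f : ℂ → ℂ} (hf : Differentiable ℂ f) {z₀ : ℂ} (h0 : f z₀ ≠ 0)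
    {K : Set ℂ} (hK : IsCompact K) : (K ∩ f ⁻¹' {0}).Finite := by
  have hane : AnalyticOnNhd ℂ f Set.univ := fun z _ => hf.analyticAt z
  by_contra hinf
  obtain ⟨x, hx, hacc⟩ := Set.Infinite.exists_accPt_of_subset_isCompact hinf hK
    Set.inter_subset_left
  rw [accPt_iff_frequently_nhdsNE] at hacc
  exact h0 (hane.eqOn_zero_of_preconnected_of_frequently_eq_zero isPreconnected_univ
    (Set.mem_univ x) (hacc.mono fun z hz => hz.2) (Set.mem_univ z₀))

lemma analyticOrderAt_ne_top_of_ne_zero {f : ℂ → ℂ} (hf : Differentiable ℂ f) {z₀ : ℂ}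
    (h0 : f z₀ ≠ 0) (z : ℂ) : analyticOrderAt f z ≠ ⊤ := by
  intro hz
  rw [analyticOrderAt_eq_top] at hz
  exact h0 (AnalyticOnNhd.eqOn_zero_of_preconnected_of_eventuallyEq_zero
    (fun z _ => hf.analyticAt z) isPreconnected_univ (Set.mem_univ z) hz (Set.mem_univ z₀))

lemma analyticAt_multiset_prod (S : Multiset ℂ) (z : ℂ) :
    AnalyticAt ℂ (fun z => (S.map fun α => z - α).prod) z := by
  induction S using Multiset.induction_on with
  | empty => simpa using analyticAt_const
  | cons x S ih =>
    simp only [Multiset.map_cons, Multiset.prod_cons]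
    exact (analyticAt_id.sub analyticAt_const).mul ih

/-- An entire function splits off its zeros at a finite set of points. -/
lemma exists_factorization_of_finset {f : ℂ → ℂ} (hf : Differentiable ℂ f)
    (hne : ∀ z, analyticOrderAt f z ≠ ⊤) (Z : Finset ℂ) :
    ∃ (S : Multiset ℂ) (u : ℂ → ℂ), (∀ z ∈ S, z ∈ Z) ∧ Differentiable ℂ u ∧
      (∀ z ∈ Z, u z ≠ 0) ∧ ∀ z, f z = (S.map fun α => z - α).prod * u z := by
  classical
  induction Z using Finset.induction_on with
  | empty => exact ⟨0, f, by simp, hf, by simp, by simp⟩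
  | insert α Z hα ih =>
    obtain ⟨S, u, hS, hu, hu0, hfu⟩ := ih
    have hmul : f = (fun z => (S.map fun α => z - α).prod) * u := funext hfu
    have htop : analyticOrderAt u α ≠ ⊤ := by
      intro h
      apply hne α
      rw [hmul, analyticOrderAt_mul (analyticAt_multiset_prod S α) (hu.analyticAt α), h]
      simp
    -- The remaining factor u may still vanish at α. Its full order n is divided out, and the
    -- removable singularity is filled with g α.
    obtain ⟨g, hg, hg0, hug⟩ := (hu.analyticAt α).analyticOrderAt_ne_top.1 htop
    set n := analyticOrderNatAt u α
    refine ⟨S + Multiset.replicate n α,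
      fun z => if z = α then g α else u z / (z - α) ^ n, ?_, ?_, ?_, ?_⟩
    · intro z hz
      rcases Multiset.mem_add.1 hz with h | h
      · exact Finset.mem_insert_of_mem (hS z h)
      · rw [Multiset.eq_of_mem_replicate h]
        exact Finset.mem_insert_self _ _
    · intro z
      by_cases hz : z = α
      · subst hz
        refine hg.differentiableAt.congr_of_eventuallyEq ?_
        filter_upwards [hug] with w hw
        split_ifs with h
        · rw [h]
        · rw [hw, smul_eq_mul, mul_div_cancel_left₀ _ (pow_ne_zero _ (sub_ne_zero.2 h))]
      · have h1 : DifferentiableAt ℂ (fun w => u w / (w - α) ^ n) z :=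
          (hu z).div (by fun_prop) (pow_ne_zero _ (sub_ne_zero.2 hz))
        refine h1.congr_of_eventuallyEq ?_
        filter_upwards [isOpen_ne.mem_nhds hz] with w hw
        rw [if_neg hw]
    · intro z hz
      by_cases h : z = α
      · simpa [h] using hg0
      · simp only [h, if_false]
        exact div_ne_zero (hu0 z ((Finset.mem_insert.1 hz).resolve_left h))
          (pow_ne_zero _ (sub_ne_zero.2 h))
    · intro z
      rw [hfu]
      simp only [Multiset.map_add, Multiset.prod_add, Multiset.map_replicate,
        Multiset.prod_replicate]
      by_cases h : z = α
      · subst h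
        simp only [if_true, mul_assoc]
        rw [hug.self_of_nhds]
        simp
      · rw [if_neg h]
        have := pow_ne_zero n (sub_ne_zero.2 h)
        field_simp

lemma analyticOrderAt_sub_const (α z : ℂ) :
    analyticOrderAt (fun w : ℂ => w - α) z = if z = α then 1 else 0 := by
  split_ifs with h
  · subst h
    have : AnalyticAt ℂ (fun w : ℂ => w - z) z := by fun_prop
    rw [show (1 : ℕ∞) = ((1 : ℕ) : ℕ∞) from rfl, this.analyticOrderAt_eq_natCast]
    exact ⟨fun _ => 1, analyticAt_const, one_ne_zero, by simp⟩
  · have : AnalyticAt ℂ (fun w : ℂ => w - α) z := by fun_prop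
    exact this.analyticOrderAt_eq_zero.2 (sub_ne_zero.2 h)

open Classical in
lemma analyticOrderAt_multiset_prod (S : Multiset ℂ) (z : ℂ) :
    analyticOrderAt (fun z => (S.map fun α => z - α).prod) z = S.count z := by
  induction S using Multiset.induction_on with
  | empty =>
    simp only [Multiset.map_zero, Multiset.prod_zero, Multiset.count_zero, Nat.cast_zero]
    exact (analyticAt_const (v := (1 : ℂ))).analyticOrderAt_eq_zero.2 one_ne_zero
  | cons x S ih =>
    simp only [Multiset.map_cons, Multiset.prod_cons]
    rw [show (fun z => (z - x) * (S.map fun α => z - α).prod) =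
      (fun z => z - x) * (fun z => (S.map fun α => z - α).prod) from rfl,
      analyticOrderAt_mul (by fun_prop) (analyticAt_multiset_prod S z), ih,
      analyticOrderAt_sub_const, Multiset.count_cons]
    split_ifs <;> simp [add_comm]

open Classical in
/-- The argument principle on a rectangle: the zeros in the interior are listed by a multiset whose
cardinality is determined by the integral of the logarithmic derivative. -/
lemma exists_zero_multiset {f : ℂ → ℂ} (hab : a < b) (hcd : c < d) (hf : Differentiable ℂ f)
    (h0 : ∀ z ∈ rectBoundary a b c d, f z ≠ 0) {γ : ℂ} (hγ : γ ∈ openRect a b c d) :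
    ∃ S : Multiset ℂ, (∀ z ∈ S, z ∈ openRect a b c d) ∧
      (∀ z ∈ closedRect a b c d, analyticOrderNatAt f z = S.count z) ∧
      rectIntegral (logDeriv f) a b c d =
        S.card * rectIntegral (fun z => (z - γ)⁻¹) a b c d := by
  obtain ⟨z₀, hz₀⟩ : (rectBoundary a b c d).Nonempty :=
    ⟨_, (horizontal_mem_rectBoundary hcd.le (Set.left_mem_Icc.2 hab.le)).1⟩
  have hne := analyticOrderAt_ne_top_of_ne_zero hf (h0 z₀ hz₀)
  have hfin := finite_zeros_inter_compact hf (h0 z₀ hz₀)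
    (isCompact_closedRect (a := a) (b := b) (c := c) (d := d))
  obtain ⟨S, u, hS, hu, hu0, hfu⟩ := exists_factorization_of_finset hf hne hfin.toFinset
  have hS' : ∀ z ∈ S, z ∈ openRect a b c d := by
    intro z hz
    have := hS z hz
    rw [Set.Finite.mem_toFinset] at this
    by_contra h
    exact h0 z ⟨this.1, h⟩ this.2
  have hu1 : ∀ z ∈ closedRect a b c d, u z ≠ 0 := by
    intro z hz h
    refine hu0 z (hfin.mem_toFinset.2 ⟨hz, ?_⟩) h
    simp [hfu, h]
  refine ⟨S, hS', fun z hz => ?_, ?_⟩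
  · rw [analyticOrderNatAt, show f = (fun z => (S.map fun α => z - α).prod) * u from funext hfu,
      analyticOrderAt_mul (analyticAt_multiset_prod S z) (hu.analyticAt z),
      analyticOrderAt_multiset_prod, (hu.analyticAt z).analyticOrderAt_eq_zero.2 (hu1 z hz)]
    simp
  -- The logarithmic derivative of the product is a sum: each listed zero contributes the same
  -- integral as the reference point γ, and the zero-free factor contributes 0 by Cauchy's theorem.
  · obtain rfl : f = fun z => (S.map fun α => z - α).prod * u z := funext hfu
    clear hfu hu0 hS hfin hne h0 hf
    induction S using Multiset.induction_on with
    | empty => simpa using rectIntegral_logDeriv_eq_zero_of_ne_zero hab.le hcd.le hu hu1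
    | cons x S ih =>
      have hx := hS' x (Multiset.mem_cons_self x S)
      have hT := fun z hz => hS' z (Multiset.mem_cons_of_mem hz)
      have hd : Differentiable ℂ fun z => (S.map fun α => z - α).prod * u z := fun z =>
        (analyticAt_multiset_prod S z).differentiableAt.mul (hu z)
      have hd0 : ∀ z ∈ rectBoundary a b c d, (S.map fun α => z - α).prod * u z ≠ 0 := by
        intro z hz
        refine mul_ne_zero (Multiset.prod_ne_zero ?_) (hu1 z hz.1)
        intro h
        obtain ⟨α, hα, h⟩ := Multiset.mem_map.1 h
        exact ne_of_mem_rectBoundary (hT α hα) hz h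
      have hc : ContinuousOn (fun z => (z - x)⁻¹) (rectBoundary a b c d) :=
        (continuousOn_id.sub continuousOn_const).inv₀ fun z hz => ne_of_mem_rectBoundary hx hz
      rw [rectIntegral_congr hab.le hcd.le (g := fun z => (z - x)⁻¹ +
        logDeriv (fun z => (S.map fun α => z - α).prod * u z) z), rectIntegral_add hab.le hcd.le hc
        (continuousOn_logDeriv hd hd0), ih hT, rectIntegral_sub_inv_eq hx hγ]
      · simp only [Multiset.card_cons]
        push_cast
        ring
      · intro z hz
        simp only [Multiset.map_cons, Multiset.prod_cons, mul_assoc]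
        rw [logDeriv_mul (f := fun z => z - x) z (ne_of_mem_rectBoundary hx hz) (hd0 z hz) (by fun_prop) (hd z)]
        simp [logDeriv_apply]

/-- **Rouché's theorem** on a rectangle. -/
theorem rouche_rect {f g : ℂ → ℂ} (hab : a < b) (hcd : c < d) (hf : Differentiable ℂ f)
    (hg : Differentiable ℂ g) (h : ∀ z ∈ rectBoundary a b c d, ‖g z - f z‖ < ‖f z‖) :
    ∃ S T : Finset (ℂ × ℕ), S.card = T.card ∧
      (∀ q, q ∈ S ↔ q.1 ∈ closedRect a b c d ∧ q.2 < analyticOrderNatAt f q.1) ∧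
      (∀ q, q ∈ T ↔ q.1 ∈ closedRect a b c d ∧ q.2 < analyticOrderNatAt g q.1) := by
  classical
  have hf0 : ∀ z ∈ rectBoundary a b c d, f z ≠ 0 := fun z hz =>
    norm_pos_iff.1 ((norm_nonneg _).trans_lt (h z hz))
  have hg0 : ∀ z ∈ rectBoundary a b c d, g z ≠ 0 := by
    intro z hz h0
    have := h z hz
    simp [h0] at this
  have hγ : (((a + b) / 2 : ℝ) + ((c + d) / 2 : ℝ) * Complex.I : ℂ) ∈ openRect a b c d := by
    simp only [openRect, Complex.mem_reProdIm, Set.mem_Ioo]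
    simp only [Complex.add_re, Complex.ofReal_re, Complex.mul_re, Complex.I_re, mul_zero,
      Complex.ofReal_im, Complex.I_im, mul_one, sub_self, add_zero, Complex.add_im, Complex.mul_im,
      zero_add]
    constructor <;> constructor <;> linarith
  obtain ⟨S, hS, hSf, hIf⟩ := exists_zero_multiset hab hcd hf hf0 hγ
  obtain ⟨T, hT, hTg, hIg⟩ := exists_zero_multiset hab hcd hg hg0 hγ
  have hcard : S.card = T.card := by
    -- On the boundary |g/f - 1| < 1, so g/f takes values in the slit plane.
    have key : rectIntegral (logDeriv fun z => g z / f z) a b c d = 0 := by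
      refine rectIntegral_logDeriv_eq_zero hab.le hcd.le
        (fun z hz => (hg.analyticAt z).div (hf.analyticAt z) (hf0 z hz)) fun z hz => ?_
      apply Complex.mem_slitPlane_of_norm_lt_one (z := g z / f z - 1) ?_ |> fun h => by simpa using h
      rw [div_sub_one (hf0 z hz), norm_div, div_lt_one (norm_pos_iff.2 (hf0 z hz))]
      exact h z hz
    have h2 : rectIntegral (logDeriv g) a b c d = rectIntegral (logDeriv f) a b c d := by
      rw [rectIntegral_congr hab.le hcd.le (f := logDeriv g)
        (g := fun z => logDeriv (fun z => g z / f z) z + logDeriv f z), rectIntegral_add hab.le hcd.le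
        _ (continuousOn_logDeriv hf hf0), key, zero_add]
      · exact fun z hz => (((hg.analyticAt z).div (hf.analyticAt z) (hf0 z hz)).deriv.div
          ((hg.analyticAt z).div (hf.analyticAt z) (hf0 z hz))
          (div_ne_zero (hg0 z hz) (hf0 z hz))).continuousAt.continuousWithinAt
      · intro z hz
        rw [logDeriv_div z (hg0 z hz) (hf0 z hz) (hg z) (hf z)]
        ring
    rw [hIf, hIg] at h2
    have := mul_right_cancel₀ (rectIntegral_sub_inv_ne_zero hγ) h2
    exact_mod_cast this.symm
  refine ⟨S.toEnumFinset, T.toEnumFinset, by simpa using hcard, fun q => ?_, fun q => ?_⟩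
  · rw [Multiset.mem_toEnumFinset]
    refine ⟨fun hq => ?_, fun hq => hSf q.1 hq.1 ▸ hq.2⟩
    have := openRect_subset_closedRect (hS q.1 (Multiset.count_pos.1 (by omega)))
    exact ⟨this, by rwa [hSf q.1 this]⟩
  · rw [Multiset.mem_toEnumFinset]
    refine ⟨fun hq => ?_, fun hq => hTg q.1 hq.1 ▸ hq.2⟩
    have := openRect_subset_closedRect (hT q.1 (Multiset.count_pos.1 (by omega)))
    exact ⟨this, by rwa [hTg q.1 this]⟩

end SelfSimilar

namespace SelfSimilar
variable {N : ℕ}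

/-! ## Dirichlet polynomials -/

/-- The Dirichlet polynomial `1 - ∑ u_j e^{-w_j s}`. -/
def dirichletPoly (w : Fin N → ℝ) (u : Fin N → ℂ) (s : ℂ) : ℂ :=
  1 - ∑ j, u j * Complex.exp (-(w j * s))

lemma differentiable_dirichletPoly (w : Fin N → ℝ) (u : Fin N → ℂ) :
    Differentiable ℂ (dirichletPoly w u) := by
  unfold dirichletPoly
  fun_prop

/-- Moving up by τ amounts to changing unimodular coefficients, so all heights are covered by one
compact family of polynomials. -/
lemma dirichletPoly_add_mul_I (w : Fin N → ℝ) (τ : ℝ) (s : ℂ) :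
    dirichletPoly w 1 (s + τ * Complex.I) =
      dirichletPoly w (fun j => Complex.exp ((-(w j * τ) : ℝ) * Complex.I)) s := by
  simp only [dirichletPoly, Pi.one_apply, one_mul, ← Complex.exp_add]
  congr 1
  refine Finset.sum_congr rfl fun j _ => ?_
  congr 1
  push_cast
  ring

lemma norm_exp_neg_mul (x : ℝ) (s : ℂ) : ‖Complex.exp (-(x * s))‖ = Real.exp (-(x * s.re)) := by
  simp [Complex.norm_exp]

/-- The polynomial tends to 1 along the positive real axis. -/
lemma exists_dirichletPoly_ne_zero {w : Fin N → ℝ} (hw : ∀ j, 0 < w j) (u : Fin N → ℂ) :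
    ∃ s, dirichletPoly w u s ≠ 0 := by
  have h : Tendsto (fun x : ℝ => dirichletPoly w u x) atTop (𝓝 (1 - ∑ j : Fin N, u j * 0)) := by
    refine tendsto_const_nhds.sub (tendsto_finsetSum _ fun j _ => tendsto_const_nhds.mul ?_)
    rw [tendsto_zero_iff_norm_tendsto_zero]
    simp only [norm_exp_neg_mul, Complex.ofReal_re]
    exact Real.tendsto_exp_neg_atTop_nhds_zero.comp (tendsto_id.const_mul_atTop (hw j))
  simp only [mul_zero, Finset.sum_const_zero, sub_zero] at h
  obtain ⟨x, hx⟩ := (h.eventually_ne one_ne_zero).exists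
  exact ⟨x, hx⟩

/-- Among a one-parameter family of disjoint segments there is one on which a Dirichlet polynomial
is bounded away from zero, uniformly in unimodular coefficients. -/
lemma exists_uniform_lower_bound {w : Fin N → ℝ} (hw : ∀ j, 0 < w j) (σ : ℝ → ℝ → ℂ)
    (hσ : Continuous fun p : ℝ × ℝ => σ p.1 p.2) (π : ℂ → ℝ) (hπ : ∀ t p, π (σ t p) = t)
    {α β A B : ℝ} (hαβ : α < β) :
    ∃ η > 0, ∀ u : Fin N → ℂ, (∀ j, ‖u j‖ = 1) → ∃ t ∈ Set.Ioo α β, ∀ p ∈ Set.Icc A B,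
      η ≤ ‖dirichletPoly w u (σ t p)‖ := by
  have hcpt : IsCompact (Set.univ.pi fun _ : Fin N => Metric.sphere (0 : ℂ) 1) :=
    isCompact_univ_pi fun _ => isCompact_sphere 0 1
  suffices h : ∃ η > 0, ∀ u ∈ Set.univ.pi fun _ : Fin N => Metric.sphere (0 : ℂ) 1,
      ∃ t ∈ Set.Ioo α β, ∀ p ∈ Set.Icc A B, η ≤ ‖dirichletPoly w u (σ t p)‖ by
    obtain ⟨η, hη, h⟩ := h
    exact ⟨η, hη, fun u hu => h u fun j _ => by simpa using hu j⟩
  -- Compactness of the torus of coefficients reduces the claim to a neighbourhood of one u, where a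
  -- single segment serves.
  refine hcpt.induction_on (p := fun S => ∃ η > 0, ∀ u ∈ S, ∃ t ∈ Set.Ioo α β, ∀ p ∈ Set.Icc A B,
    η ≤ ‖dirichletPoly w u (σ t p)‖) ⟨1, one_pos, by simp⟩ ?_ ?_ ?_
  · rintro s t hst ⟨η, hη, h⟩
    exact ⟨η, hη, fun u hu => h u (hst hu)⟩
  · rintro s t ⟨η₁, h₁, H₁⟩ ⟨η₂, h₂, H₂⟩
    refine ⟨min η₁ η₂, lt_min h₁ h₂, ?_⟩
    rintro u (hu | hu)
    · obtain ⟨t, ht, h⟩ := H₁ u hu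
      exact ⟨t, ht, fun p hp => (min_le_left _ _).trans (h p hp)⟩
    · obtain ⟨t, ht, h⟩ := H₂ u hu
      exact ⟨t, ht, fun p hp => (min_le_right _ _).trans (h p hp)⟩
  · intro u _
    obtain ⟨z₀, hz₀⟩ := exists_dirichletPoly_ne_zero hw u
    have hK : IsCompact ((fun p : ℝ × ℝ => σ p.1 p.2) '' (Set.Icc α β ×ˢ Set.Icc A B)) :=
      (isCompact_Icc.prod isCompact_Icc).image hσ
    -- Finitely many zeros lie in the region swept by the segments, and `π` recovers the parameter
    -- of each, so only finitely many t are bad.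
    have hfin := (finite_zeros_inter_compact (differentiable_dirichletPoly w u) hz₀ hK).image π
    obtain ⟨t, ht, htn⟩ := (Set.Ioo_infinite hαβ).exists_notMem_finite hfin
    have hne : ∀ p ∈ Set.Icc A B, dirichletPoly w u (σ t p) ≠ 0 := fun p hp h0 =>
      htn ⟨σ t p, ⟨⟨(t, p), ⟨Set.Ioo_subset_Icc_self ht, hp⟩, rfl⟩, h0⟩, hπ t p⟩
    have hcont : Continuous fun q : (Fin N → ℂ) × ℝ => ‖dirichletPoly w q.1 (σ t q.2)‖ := by
      have : Continuous fun q : (Fin N → ℂ) × ℝ => σ t q.2 :=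
        hσ.comp (continuous_const.prodMk continuous_snd)
      unfold dirichletPoly
      fun_prop
    obtain ⟨η, hη, hηp⟩ : ∃ η > 0, ∀ p ∈ Set.Icc A B, η < ‖dirichletPoly w u (σ t p)‖ := by
      rcases (Set.Icc A B).eq_empty_or_nonempty with he | hne'
      · exact ⟨1, one_pos, by simp [he]⟩
      · obtain ⟨p₀, hp₀, hmin⟩ := (isCompact_Icc (a := A) (b := B)).exists_isMinOn hne'
          (hcont.comp (Continuous.prodMk_right u)).continuousOn
        have hpos := norm_pos_iff.2 (hne p₀ hp₀)
        exact ⟨_, half_pos hpos, fun p hp => (half_lt_self hpos).trans_le (hmin hp)⟩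
    have hev : ∀ᶠ u' in 𝓝 u, ∀ p ∈ Set.Icc A B, η < ‖dirichletPoly w u' (σ t p)‖ :=
      isCompact_Icc.eventually_forall_of_forall_eventually fun p hp =>
        hcont.continuousAt.eventually (lt_mem_nhds (hηp p hp))
    exact ⟨_, mem_nhdsWithin_of_mem_nhds hev, η, hη, fun u' hu' => ⟨t, ht, fun p hp =>
      (hu' p hp).le⟩⟩

/-- The zeros of `1 - ∑ e^{-w'_j s}` lie in a fixed vertical strip for all `w'` close to `w` that
have the same coincidences among their components. -/
lemma exists_re_bound {w : Fin N → ℝ} (hw : ∀ j, 0 < w j) :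
    ∃ R > 0, ∃ κ > 0, ∀ w' : Fin N → ℝ, (∀ j, |w' j - w j| < κ) →
      (∀ j k, w j = w k → w' j = w' k) → ∀ s, dirichletPoly w' 1 s = 0 → |s.re| < R := by
  rcases isEmpty_or_nonempty (Fin N) with hN | hN
  · exact ⟨1, one_pos, 1, one_pos, fun w' _ _ s hs => by simp [dirichletPoly] at hs⟩
  obtain ⟨j₀, hj₀⟩ := Finite.exists_max w
  -- After perturbations below c, the margins 2c and 3c leave all weights at least c and every
  -- weight not tied with the largest at least c below it.
  obtain ⟨c, hc, hc1, hc2⟩ : ∃ c > 0, (∀ j, 2 * c ≤ w j) ∧ ∀ j, w j ≠ w j₀ → w j + 3 * c ≤ w j₀ := by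
    have h1 : ∀ᶠ c in 𝓝[>] (0 : ℝ), ∀ j, 2 * c ≤ w j := by
      refine eventually_all.2 fun j => mem_nhdsWithin_of_mem_nhds ?_
      have : Tendsto (fun c : ℝ => 2 * c) (𝓝 0) (𝓝 (2 * 0)) := tendsto_id.const_mul 2
      rw [mul_zero] at this
      exact this.eventually (ge_mem_nhds (hw j))
    have h2 : ∀ᶠ c in 𝓝[>] (0 : ℝ), ∀ j, w j ≠ w j₀ → w j + 3 * c ≤ w j₀ := by
      refine eventually_all.2 fun j => mem_nhdsWithin_of_mem_nhds ?_
      by_cases h : w j = w j₀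
      · simp [h]
      have : Tendsto (fun c : ℝ => w j + 3 * c) (𝓝 0) (𝓝 (w j + 3 * 0)) :=
        (tendsto_id.const_mul 3).const_add _
      rw [mul_zero, add_zero] at this
      filter_upwards [this.eventually (ge_mem_nhds (lt_of_le_of_ne (hj₀ j) h))] with c hc _ using hc
    obtain ⟨c, ⟨h1, h2⟩, h3⟩ := ((h1.and h2).and self_mem_nhdsWithin).exists
    exact ⟨c, h3, h1, h2⟩
  obtain ⟨R, hR0, hR⟩ : ∃ R > 0, (N + 1 : ℝ) * Real.exp (-(c * R)) < 1 := by
    have : Tendsto (fun R : ℝ => (N + 1 : ℝ) * Real.exp (-(c * R))) atTop (𝓝 ((N + 1 : ℝ) * 0)) :=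
      (Real.tendsto_exp_neg_atTop_nhds_zero.comp (tendsto_id.const_mul_atTop hc)).const_mul _
    rw [mul_zero] at this
    obtain ⟨R, h1, h2⟩ := ((this.eventually (gt_mem_nhds one_pos)).and (eventually_gt_atTop 0)).exists
    exact ⟨R, h2, h1⟩
  refine ⟨R, hR0, c, hc, fun w' hw' htie s hs => ?_⟩
  have hw'' := fun j => abs_lt.1 (hw' j)
  have hs1 : ∑ j, Complex.exp (-(w' j * s)) = 1 := by
    have h1 : 1 - ∑ j, Complex.exp (-(w' j * s)) = 0 := by simpa [dirichletPoly] using hs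
    exact (sub_eq_zero.1 h1).symm
  rw [abs_lt]
  constructor
  -- Far to the left, divide by the term of `j₀`. Terms tied with it become exactly 1 and cannot
  -- cancel, so they sum to at least 1. All the others, and the constant term, are at most e^{-cR}
  -- in modulus.
  · by_contra! hle
    classical
    have hs2 : ∑ j, Complex.exp (-((w' j - w' j₀ : ℝ) * s)) = Complex.exp (w' j₀ * s) := by
      rw [← mul_one (Complex.exp (w' j₀ * s)), ← hs1, Finset.mul_sum]
      refine Finset.sum_congr rfl fun j _ => ?_
      rw [← Complex.exp_add]
      congr 1
      push_cast
      ring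
    rw [← Finset.sum_filter_add_sum_filter_not _ (fun j => w j = w j₀)] at hs2
    set J := Finset.univ.filter fun j => w j = w j₀
    have hJ : ∑ j ∈ J, Complex.exp (-((w' j - w' j₀ : ℝ) * s)) = J.card := by
      rw [Finset.sum_congr rfl (g := fun _ => (1 : ℂ)), Finset.sum_const, nsmul_one]
      intro j hj
      rw [htie j j₀ (Finset.mem_filter.1 hj).2]
      simp
    have hcard : (1 : ℝ) ≤ J.card := by
      exact_mod_cast Finset.card_pos.2 ⟨j₀, by simp [J]⟩
    have hrest : ‖∑ j ∈ Finset.univ.filter (fun j => ¬ w j = w j₀),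
        Complex.exp (-((w' j - w' j₀ : ℝ) * s))‖ ≤ N * Real.exp (-(c * R)) := by
      calc _ ≤ ∑ j ∈ Finset.univ.filter (fun j => ¬ w j = w j₀), Real.exp (-(c * R)) := by
            refine norm_sum_le_of_le _ fun j hj => ?_
            rw [norm_exp_neg_mul, Real.exp_le_exp]
            have h1 := hc2 j (Finset.mem_filter.1 hj).2
            nlinarith [hw'' j, hw'' j₀]
        _ ≤ _ := by
            rw [Finset.sum_const, nsmul_eq_mul]
            gcongr
            simpa using Finset.card_filter_le (Finset.univ : Finset (Fin N)) _
    have hright : ‖Complex.exp (w' j₀ * s)‖ ≤ Real.exp (-(c * R)) := by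
      have := norm_exp_neg_mul (-(w' j₀)) s
      simp only [Complex.ofReal_neg, neg_mul, neg_neg] at this
      rw [this, Real.exp_le_exp]
      nlinarith [hw'' j₀, hc1 j₀]
    have : (J.card : ℂ) = Complex.exp (w' j₀ * s) - ∑ j ∈ Finset.univ.filter
        (fun j => ¬ w j = w j₀), Complex.exp (-((w' j - w' j₀ : ℝ) * s)) := by
      rw [← hs2, hJ]
      ring
    have h2 := norm_sub_le (Complex.exp (w' j₀ * s)) (∑ j ∈ Finset.univ.filter
        (fun j => ¬ w j = w j₀), Complex.exp (-((w' j - w' j₀ : ℝ) * s)))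
    rw [← this, Complex.norm_natCast] at h2
    linarith
  -- Far to the right all exponentials are too small to sum to 1.
  · by_contra! hle
    have h1 : (1 : ℝ) ≤ N * Real.exp (-(c * R)) := by
      calc (1 : ℝ) = ‖∑ j, Complex.exp (-(w' j * s))‖ := by rw [hs1, norm_one]
        _ ≤ ∑ j : Fin N, Real.exp (-(c * R)) := by
            refine norm_sum_le_of_le _ fun j _ => ?_
            rw [norm_exp_neg_mul, Real.exp_le_exp]
            nlinarith [hw'' j, hc1 j]
        _ = _ := by simp
    have := Real.exp_pos (-(c * R))
    linarith

/-- Each difference factors as e^{-w_j s}(e^{-(w'_j - w_j)s} - 1), and |e^z - 1| ≤ 2|z| for |z| ≤ 1.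
What counts is the perturbation of the weights times the size of s. -/
lemma norm_dirichletPoly_sub_le {w w' : Fin N → ℝ} {s : ℂ} {D W R : ℝ} (hW : ∀ j, |w j| ≤ W)
    (hR : |s.re| ≤ R) (hD : ∀ j, |w' j - w j| * ‖s‖ ≤ D) (hD1 : D ≤ 1) :
    ‖dirichletPoly w' 1 s - dirichletPoly w 1 s‖ ≤ N * (Real.exp (W * R) * (2 * D)) := by
  have : dirichletPoly w' 1 s - dirichletPoly w 1 s =
      -∑ j, (Complex.exp (-(w' j * s)) - Complex.exp (-(w j * s))) := by
    simp only [dirichletPoly, Pi.one_apply, one_mul, Finset.sum_sub_distrib]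
    ring
  rw [this, norm_neg]
  calc _ ≤ ∑ j : Fin N, Real.exp (W * R) * (2 * D) := by
        refine norm_sum_le_of_le _ fun j _ => ?_
        have h1 : Complex.exp (-(w' j * s)) - Complex.exp (-(w j * s)) =
            Complex.exp (-(w j * s)) * (Complex.exp (-((w' j - w j : ℝ) * s)) - 1) := by
          rw [mul_sub, mul_one, ← Complex.exp_add]
          congr 2
          push_cast
          ring
        have h2 : ‖-(((w' j - w j : ℝ) : ℂ) * s)‖ ≤ D := by
          rw [norm_neg, norm_mul, Complex.norm_real]
          exact hD j
        rw [h1, norm_mul, norm_exp_neg_mul]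
        gcongr
        · have h3 := mul_le_mul (hW j) hR (abs_nonneg _) ((abs_nonneg _).trans (hW j))
          rw [← abs_mul] at h3
          exact (neg_le_abs _).trans h3
        · exact (Complex.norm_exp_sub_one_le (h2.trans hD1)).trans (by gcongr)
    _ = _ := by simp

/-- If k is the integer part of t/ε, then t and `y k` lie in the same interval of length ε, so t
belongs to cell k or to cell k - 1. -/
lemma exists_grid_index {ε : ℝ} (hε : 0 < ε) {y : ℤ → ℝ}
    (hy : ∀ k : ℤ, y k ∈ Set.Ioo (k * ε) ((k + 1) * ε)) (t : ℝ) :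
    ∃ k : ℤ, t ∈ Set.Icc (y k) (y (k + 1)) := by
  have h1 := Int.floor_le (t / ε)
  have h2 := Int.lt_floor_add_one (t / ε)
  rw [le_div_iff₀ hε] at h1
  rw [div_lt_iff₀ hε] at h2
  set k := ⌊t / ε⌋
  rcases le_total (y k) t with h | h
  · refine ⟨k, h, ?_⟩
    have := (hy (k + 1)).1
    push_cast at this
    linarith
  · refine ⟨k - 1, ?_, by simpa using h⟩
    have := (hy (k - 1)).2
    push_cast at this
    linarith

lemma grid_index_unique {ε : ℝ} {y : ℤ → ℝ}
    (hy : ∀ k : ℤ, y k ∈ Set.Ioo (k * ε) ((k + 1) * ε)) {t : ℝ} {k l : ℤ}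
    (hk : t ∈ Set.Ioo (y k) (y (k + 1))) (hl : t ∈ Set.Ioo (y l) (y (l + 1))) : k = l := by
  have hm : StrictMono y := strictMono_int_of_lt_succ fun n => by
    have h1 := (hy n).2
    have h2 := (hy (n + 1)).1
    push_cast at h2
    linarith
  have h1 := hm.lt_iff_lt.1 (hk.1.trans hl.2)
  have h2 := hm.lt_iff_lt.1 (hl.1.trans hk.2)
  omega

/-- Points that are grouped into disjoint cells of equal finite cardinalities can be matched within
the cells. -/
lemma exists_cellwise_matching {ι α : Type*} (S T : ι → Finset α)
    (hcard : ∀ i, (S i).card = (T i).card)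
    (hS : ∀ i j q, q ∈ S i → q ∈ S j → i = j) (hT : ∀ i j q, q ∈ T i → q ∈ T j → i = j) :
    ∃ f : α → α, Set.InjOn f (⋃ i, (S i : Set α)) ∧ (∀ i, ∀ q ∈ S i, f q ∈ T i) ∧
      ∀ i, ∀ p ∈ T i, ∃ q ∈ S i, f q = p := by
  classical
  have e := fun i => (Finset.equivOfCardEq (hcard i))
  let f : α → α := fun q => if h : ∃ i, q ∈ S i then e h.choose ⟨q, h.choose_spec⟩ else q
  have hf : ∀ i q (hq : q ∈ S i), f q = e i ⟨q, hq⟩ := by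
    intro i q hq
    have h : ∃ i, q ∈ S i := ⟨i, hq⟩
    simp only [f, dif_pos h]
    have hi : h.choose = i := hS _ _ q h.choose_spec hq
    have : ∀ k (hk : k = i) (hqk : q ∈ S k), (e k ⟨q, hqk⟩ : α) = e i ⟨q, hq⟩ := by
      rintro k rfl hqk
      rfl
    exact this _ hi _
  refine ⟨f, ?_, fun i q hq => hf i q hq ▸ (e i ⟨q, hq⟩).2, fun i p hp => ?_⟩
  · intro q hq q' hq' h
    obtain ⟨i, hi⟩ := Set.mem_iUnion.1 hq
    obtain ⟨i', hi'⟩ := Set.mem_iUnion.1 hq'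
    have hi : q ∈ S i := hi
    have hi' : q' ∈ S i' := hi'
    rw [hf i q hi, hf i' q' hi'] at h
    obtain rfl : i = i' := hT _ _ _ (e i ⟨q, hi⟩).2 (h ▸ (e i' ⟨q', hi'⟩).2)
    simpa using (e i).injective (Subtype.ext h)
  · refine ⟨(e i).symm ⟨p, hp⟩, ((e i).symm ⟨p, hp⟩).2, ?_⟩
    rw [hf i _ ((e i).symm ⟨p, hp⟩).2]
    simp

end SelfSimilar

namespace SelfSimilar
variable {N : ℕ}

/-! ### Matching the zeros of nearby Dirichlet polynomials in tall strips -/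

lemma eq_zero_of_lt_analyticOrderNatAt {f : ℂ → ℂ} (hf : Differentiable ℂ f) {z : ℂ} {n : ℕ}
    (h : n < analyticOrderNatAt f z) : f z = 0 := by
  by_contra h0
  rw [analyticOrderNatAt, (hf.analyticAt z).analyticOrderAt_eq_zero.2 h0] at h
  simp at h

/-- A grid of cells on whose boundaries `1 - ∑ e^{-w_j s}` is bounded away from zero. -/
lemma exists_grid {w : Fin N → ℝ} (hw : ∀ j, 0 < w j) {ε : ℝ} (hε : 0 < ε) (K : ℕ) :
    ∃ η > 0, ∃ (y : ℤ → ℝ) (x : ℤ → ℤ → ℝ),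
      (∀ k : ℤ, y k ∈ Set.Ioo (k * ε) ((k + 1) * ε)) ∧
      (∀ k i : ℤ, x k i ∈ Set.Ioo (i * ε) ((i + 1) * ε)) ∧
      ∀ k i : ℤ, |i| ≤ K → ∀ z ∈ rectBoundary (x k i) (x k (i + 1)) (y k) (y (k + 1)),
        η ≤ ‖dirichletPoly w 1 z‖ := by
  have hunit : ∀ τ : ℝ, ∀ j, ‖Complex.exp ((-(w j * τ) : ℝ) * Complex.I)‖ = 1 := fun τ j =>
    Complex.norm_exp_ofReal_mul_I _
  -- Horizontal grid lines: one constant serves every row k, after translation by kε.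
  obtain ⟨η₁, hη₁, H₁⟩ := exists_uniform_lower_bound hw (fun t p => (p + t * Complex.I : ℂ))
    (by fun_prop) Complex.im (by simp) (A := -((K + 3) * ε)) (B := (K + 3) * ε) hε
  -- Vertical grid lines, chosen anew in each row, so that only segments of bounded height are
  -- needed. The height 2ε covers a row between `y k` and `y (k + 1)`.
  have H₂ : ∀ i : ℤ, ∃ η > 0, ∀ u : Fin N → ℂ, (∀ j, ‖u j‖ = 1) →
      ∃ t ∈ Set.Ioo (i * ε) ((i + 1) * ε), ∀ p ∈ Set.Icc 0 (2 * ε),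
        η ≤ ‖dirichletPoly w u (t + p * Complex.I)‖ := fun i =>
    exists_uniform_lower_bound hw (fun t p => (t + p * Complex.I : ℂ))
      (by fun_prop) Complex.re (by simp) (by linarith)
  choose η₂ hη₂ H₂ using H₂
  have hy : ∀ k : ℤ, ∃ t ∈ Set.Ioo (k * ε) ((k + 1) * ε), ∀ p ∈ Set.Icc (-((K + 3) * ε))
      ((K + 3) * ε), η₁ ≤ ‖dirichletPoly w 1 (p + t * Complex.I)‖ := by
    intro k
    obtain ⟨t, ht, h⟩ := H₁ _ (hunit (k * ε))
    refine ⟨k * ε + t, ⟨by linarith [ht.1], by linarith [ht.2]⟩, fun p hp => ?_⟩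
    have := h p hp
    rw [← dirichletPoly_add_mul_I] at this
    convert this using 3
    push_cast
    ring
  choose y hy hyη using hy
  have hx : ∀ k i : ℤ, ∃ t ∈ Set.Ioo (i * ε) ((i + 1) * ε), ∀ p ∈ Set.Icc (k * ε) ((k + 2) * ε),
      η₂ i ≤ ‖dirichletPoly w 1 (t + p * Complex.I)‖ := by
    intro k i
    obtain ⟨t, ht, h⟩ := H₂ i _ (hunit (k * ε))
    refine ⟨t, ht, fun p hp => ?_⟩
    have := h (p - k * ε) ⟨by linarith [hp.1], by linarith [hp.2]⟩
    rw [← dirichletPoly_add_mul_I] at this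
    convert this using 3
    push_cast
    ring
  choose x hx hxη using hx
  -- The constants depend on the column, but only finitely many columns occur; K + 1 is included for
  -- the right edge of column K.
  obtain ⟨η₃, hη₃, hle⟩ : ∃ η > 0, ∀ i ∈ Finset.Icc (-(K + 1) : ℤ) (K + 1), η ≤ η₂ i := by
    have hne : (Finset.Icc (-(K + 1) : ℤ) (K + 1)).Nonempty := ⟨0, by simp; omega⟩
    obtain ⟨i₀, _, h⟩ := Finset.exists_min_image _ η₂ hne
    exact ⟨η₂ i₀, hη₂ i₀, h⟩
  refine ⟨min η₁ η₃, lt_min hη₁ hη₃, y, x, hy, hx, fun k i hi z hz => ?_⟩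
  obtain ⟨⟨⟨h1, h2⟩, h3, h4⟩, hno⟩ := hz
  have hi' := abs_le.1 hi
  have hiR : (-K : ℝ) ≤ i ∧ (i : ℝ) ≤ K := by exact_mod_cast hi'
  have hxi := hx k i
  have hxi' := hx k (i + 1)
  have hyk := hy k
  have hyk' := hy (k + 1)
  push_cast at hxi' hyk'
  have hzre : z.re ∈ Set.Icc (-((K + 3) * ε)) ((K + 3) * ε) :=
    ⟨by nlinarith [hxi.1], by nlinarith [hxi'.2]⟩
  have hzim : z.im ∈ Set.Icc (k * ε) ((k + 2) * ε) :=
    ⟨by linarith [hyk.1], by linarith [hyk'.2]⟩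
  have hm1 : min η₁ η₃ ≤ η₁ := min_le_left _ _
  have hm3 : ∀ i ∈ Finset.Icc (-(K + 1) : ℤ) (K + 1), min η₁ η₃ ≤ η₂ i := fun i hi =>
    (min_le_right _ _).trans (hle i hi)
  have hedge : z.re = x k i ∨ z.re = x k (i + 1) ∨ z.im = y k ∨ z.im = y (k + 1) := by
    by_contra! hcon
    exact hno ⟨⟨lt_of_le_of_ne h1 (Ne.symm hcon.1), lt_of_le_of_ne h2 hcon.2.1⟩,
      lt_of_le_of_ne h3 (Ne.symm hcon.2.2.1), lt_of_le_of_ne h4 hcon.2.2.2⟩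
  rw [← Complex.re_add_im z]
  rcases hedge with h | h | h | h <;> rw [h]
  · exact (hm3 i (Finset.mem_Icc.2 ⟨by omega, by omega⟩)).trans (hxη k i _ hzim)
  · exact (hm3 (i + 1) (Finset.mem_Icc.2 ⟨by omega, by omega⟩)).trans (hxη k (i + 1) _ hzim)
  · exact hm1.trans (hyη k _ hzre)
  · exact hm1.trans (hyη (k + 1) _ hzre)

/-- The zeros of `1 - ∑ e^{-w_j s}` in a strip `|Im s| < T` of large height are matched with those of
`1 - ∑ e^{-w'_j s}` if `w'` is close to `w` relative to the height. -/
theorem exists_zero_matching {w : Fin N → ℝ} (hw : ∀ j, 0 < w j) (w' : ℕ → Fin N → ℝ) (T : ℕ → ℝ)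
    (hT : Tendsto T atTop atTop)
    (hwT : ∀ j, Tendsto (fun M => |w' M j - w j| * T M) atTop (𝓝 0))
    (htie : ∀ᶠ M in atTop, ∀ j k, w j = w k → w' M j = w' M k) {ε : ℝ} (hε : 0 < ε) :
    ∀ᶠ M in atTop, ∃ f : ℂ × ℕ → ℂ × ℕ,
      Set.InjOn f (pointsBelow (analyticOrderNatAt (dirichletPoly w 1)) (T M)) ∧
      (∀ q ∈ pointsBelow (analyticOrderNatAt (dirichletPoly w 1)) (T M),
        (f q).2 < analyticOrderNatAt (dirichletPoly (w' M) 1) (f q).1 ∧ dist (f q).1 q.1 < ε) ∧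
      pointsBelow (analyticOrderNatAt (dirichletPoly (w' M) 1)) (T M - ε) ⊆
        f '' pointsBelow (analyticOrderNatAt (dirichletPoly w 1)) (T M) := by
  obtain ⟨R, hR, κ, hκ, hRb⟩ := exists_re_bound hw
  -- Cells have sides shorter than 2e, hence diameter less than ε.
  set e := ε / 4 with he
  have he0 : 0 < e := by positivity
  obtain ⟨K, hK⟩ := exists_nat_ge (R / e + 1)
  have hKR : R + e ≤ K * e := by
    have := mul_le_mul_of_nonneg_right hK he0.le
    rwa [add_mul, div_mul_cancel₀ _ he0.ne', one_mul] at this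
  obtain ⟨η, hη, y, x, hy, hx, hbd⟩ := exists_grid hw he0 K
  obtain ⟨W, hW⟩ : ∃ W, ∀ j, |w j| ≤ W := by
    obtain ⟨W, hW⟩ := (Set.finite_range fun j => |w j|).bddAbove
    exact ⟨W, fun j => hW ⟨j, rfl⟩⟩
  set B := (K + 3) * e with hB
  obtain ⟨D, hD0, hD1, hD⟩ : ∃ D > 0, D ≤ 1 ∧ N * (Real.exp (W * B) * (2 * D)) < η := by
    have : Tendsto (fun D : ℝ => N * (Real.exp (W * B) * (2 * D))) (𝓝[>] 0)
        (𝓝 (N * (Real.exp (W * B) * (2 * 0)))) :=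
      tendsto_nhdsWithin_of_tendsto_nhds
        (((tendsto_id.const_mul 2).const_mul (Real.exp (W * B))).const_mul (N : ℝ))
    simp only [mul_zero] at this
    obtain ⟨D, h1, h2⟩ := ((this.eventually (gt_mem_nhds hη)).and
      (Ioc_mem_nhdsGT (zero_lt_one' ℝ))).exists
    exact ⟨D, h2.1, h2.2, h1⟩
  have hB0 : 0 < B := by positivity
  -- On the cells used, |Re s| ≤ B and |Im s| ≤ T + 4e, so T + B + 4e bounds |s|. The bound by κ
  -- lets `exists_re_bound` apply to the perturbed weights.
  have hclose : ∀ᶠ M in atTop, ∀ j, |w' M j - w j| * (T M + (B + 4 * e)) < min D κ := by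
    refine eventually_all.2 fun j => ?_
    have h1 : Tendsto (fun M => |w' M j - w j| * T M * (1 + (B + 4 * e))) atTop
        (𝓝 (0 * (1 + (B + 4 * e)))) := (hwT j).mul_const _
    rw [zero_mul] at h1
    filter_upwards [h1.eventually (gt_mem_nhds (lt_min hD0 hκ)), hT.eventually_ge_atTop 1]
      with M h1 h2
    refine lt_of_le_of_lt ?_ h1
    rw [mul_assoc]
    gcongr
    nlinarith
  filter_upwards [hclose, htie, hT.eventually_ge_atTop 1] with M hM hMtie hT1
  have hMκ : ∀ j, |w' M j - w j| < κ := fun j => by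
    refine lt_of_le_of_lt ?_ ((hM j).trans_le (min_le_right _ _))
    exact le_mul_of_one_le_right (abs_nonneg _) (by linarith)
  have hfd := differentiable_dirichletPoly w 1
  have hgd := differentiable_dirichletPoly (w' M) 1
  have hnear : ∀ s : ℂ, |s.re| ≤ B → |s.im| ≤ T M + 4 * e →
      ‖dirichletPoly (w' M) 1 s - dirichletPoly w 1 s‖ < η := by
    intro s hre him
    refine lt_of_le_of_lt (norm_dirichletPoly_sub_le hW hre (fun j => ?_) hD1) hD
    refine le_trans ?_ ((hM j).le.trans (min_le_left _ _))
    gcongr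
    exact (Complex.norm_le_abs_re_add_abs_im s).trans (by linarith)
  set cell : ℤ × ℤ → Set ℂ := fun c =>
    closedRect (x c.1 c.2) (x c.1 (c.2 + 1)) (y c.1) (y (c.1 + 1)) with hcell
  have hxlt : ∀ k i, x k i < x k (i + 1) := fun k i => by
    have h1 := (hx k i).2
    have h2 := (hx k (i + 1)).1
    push_cast at h2
    linarith
  have hylt : ∀ k, y k < y (k + 1) := fun k => by
    have h1 := (hy k).2
    have h2 := (hy (k + 1)).1
    push_cast at h2
    linarith
  have hxw : ∀ k i, x k (i + 1) - x k i < 2 * e := fun k i => by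
    have h1 := (hx k i).1
    have h2 := (hx k (i + 1)).2
    push_cast at h2
    linarith
  have hyw : ∀ k, y (k + 1) - y k < 2 * e := fun k => by
    have h1 := (hy k).1
    have h2 := (hy (k + 1)).2
    push_cast at h2
    linarith
  have hdist : ∀ c, ∀ p ∈ cell c, ∀ q ∈ cell c, dist p q < ε ∧ |p.im - q.im| < 2 * e := by
    rintro c p ⟨⟨p1, p2⟩, p3, p4⟩ q ⟨⟨q1, q2⟩, q3, q4⟩
    have h1 : |(p - q).re| < 2 * e := by
      rw [Complex.sub_re, abs_lt]
      constructor <;> linarith [hxw c.1 c.2]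
    have h2 : |(p - q).im| < 2 * e := by
      rw [Complex.sub_im, abs_lt]
      constructor <;> linarith [hyw c.1]
    refine ⟨?_, by simpa using h2⟩
    rw [dist_eq_norm]
    exact (Complex.norm_le_abs_re_add_abs_im _).trans_lt (by linarith)
  let ι := {c : ℤ × ℤ // |c.2| ≤ K ∧ ∀ z ∈ cell c, |z.im| ≤ T M + 4 * e}
  have hlow : ∀ c : ι, ∀ z ∈ rectBoundary (x c.1.1 c.1.2) (x c.1.1 (c.1.2 + 1)) (y c.1.1)
      (y (c.1.1 + 1)), ‖dirichletPoly (w' M) 1 z - dirichletPoly w 1 z‖ < ‖dirichletPoly w 1 z‖ := by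
    rintro ⟨c, hc1, hc2⟩ z hz
    refine (hnear z ?_ (hc2 z hz.1)).trans_le (hbd c.1 c.2 hc1 z hz)
    obtain ⟨⟨h1, h2⟩, -⟩ := hz.1
    have h3 := (hx c.1 c.2).1
    have h4 := (hx c.1 (c.2 + 1)).2
    have h5 : (-K : ℝ) ≤ c.2 ∧ (c.2 : ℝ) ≤ K := by exact_mod_cast abs_le.1 hc1
    push_cast at h4
    rw [abs_le, hB]
    constructor <;> nlinarith
  have hrouche := fun c : ι => rouche_rect (hxlt c.1.1 c.1.2) (hylt c.1.1) hfd hgd (hlow c)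
  choose S T' hcard hS hT' using hrouche
  -- Closed cells may share edges, but Rouché's strict inequality excludes zeros of either function
  -- there; only the disjoint open cells matter.
  have huniq : ∀ (c c' : ι) (z : ℂ),
      z ∈ openRect (x c.1.1 c.1.2) (x c.1.1 (c.1.2 + 1)) (y c.1.1) (y (c.1.1 + 1)) →
      z ∈ openRect (x c'.1.1 c'.1.2) (x c'.1.1 (c'.1.2 + 1)) (y c'.1.1) (y (c'.1.1 + 1)) →
      c = c' := by
    rintro ⟨⟨k, i⟩, hc⟩ ⟨⟨k', i'⟩, hc'⟩ z hz hz'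
    obtain rfl : k = k' := grid_index_unique hy hz.2 hz'.2
    obtain rfl : i = i' := grid_index_unique (hx k) hz.1 hz'.1
    rfl
  have hSopen : ∀ (c : ι) q, q ∈ S c →
      q.1 ∈ openRect (x c.1.1 c.1.2) (x c.1.1 (c.1.2 + 1)) (y c.1.1) (y (c.1.1 + 1)) := by
    intro c q hq
    obtain ⟨h1, h2⟩ := (hS c q).1 hq
    by_contra hcon
    have := hlow c q.1 ⟨h1, hcon⟩
    rw [eq_zero_of_lt_analyticOrderNatAt hfd h2, norm_zero] at this
    exact absurd this (norm_nonneg _).not_gt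
  have hTopen : ∀ (c : ι) q, q ∈ T' c →
      q.1 ∈ openRect (x c.1.1 c.1.2) (x c.1.1 (c.1.2 + 1)) (y c.1.1) (y (c.1.1 + 1)) := by
    intro c q hq
    obtain ⟨h1, h2⟩ := (hT' c q).1 hq
    by_contra hcon
    have := hlow c q.1 ⟨h1, hcon⟩
    rw [eq_zero_of_lt_analyticOrderNatAt hgd h2, zero_sub, norm_neg] at this
    exact absurd this (lt_irrefl _)
  obtain ⟨f, hinj, hmem, hsurj⟩ := exists_cellwise_matching S T' hcard
    (fun c c' q h h' => huniq c c' q.1 (hSopen c q h) (hSopen c' q h'))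
    (fun c c' q h h' => huniq c c' q.1 (hTopen c q h) (hTopen c' q h'))
  have hloc : ∀ z : ℂ, |z.re| < R → |z.im| < T M → ∃ c : ι, z ∈ cell c.1 := by
    intro z hre him
    obtain ⟨k, hk⟩ := exists_grid_index he0 hy z.im
    obtain ⟨i, hi⟩ := exists_grid_index he0 (hx k) z.re
    have hzc : z ∈ cell (k, i) := ⟨hi, hk⟩
    refine ⟨⟨(k, i), ?_, fun p hp => ?_⟩, hzc⟩
    · have h1 := (hx k i).1
      have h2 := (hx k (i + 1)).2
      push_cast at h2
      rw [abs_lt] at hre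
      have h3 : (i : ℝ) * e < K * e := by linarith [hi.1]
      have h4 : (-(K : ℝ) - 1) * e < i * e := by linarith [hi.2]
      have h5 := lt_of_mul_lt_mul_right h3 he0.le
      have h6 := lt_of_mul_lt_mul_right h4 he0.le
      have h7 : i < K := by exact_mod_cast h5
      have h8 : -(K : ℤ) - 1 < i := by exact_mod_cast h6
      exact abs_le.2 ⟨by omega, h7.le⟩
    · have h1 := (hdist _ p hp z hzc).2
      have h2 : |p.im| ≤ |p.im - z.im| + |z.im| := by
        simpa using abs_add_le (p.im - z.im) z.im
      linarith
  have hself : ∀ z, dirichletPoly w 1 z = 0 → |z.re| < R :=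
    hRb w (fun j => by simpa using hκ) fun _ _ h => h
  have hpS : ∀ q ∈ pointsBelow (analyticOrderNatAt (dirichletPoly w 1)) (T M), ∃ c, q ∈ S c := by
    rintro q ⟨hq1, hq2⟩
    obtain ⟨c, hc⟩ := hloc q.1 (hself _ (eq_zero_of_lt_analyticOrderNatAt hfd hq1)) hq2
    exact ⟨c, (hS c q).2 ⟨hc, hq1⟩⟩
  refine ⟨f, hinj.mono fun q hq => ?_, fun q hq => ?_, ?_⟩
  · obtain ⟨c, hc⟩ := hpS q hq
    exact Set.mem_iUnion.2 ⟨c, hc⟩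
  · obtain ⟨c, hc⟩ := hpS q hq
    have h1 := (hT' c _).1 (hmem c q hc)
    exact ⟨h1.2, (hdist _ _ h1.1 _ ((hS c q).1 hc).1).1⟩
  -- A zero of the perturbed polynomial below T - ε has its partner in the same cell, of height less
  -- than ε/2, hence below T.
  · rintro p ⟨hp1, hp2⟩
    obtain ⟨c, hc⟩ := hloc p.1 (hRb (w' M) hMκ hMtie _ (eq_zero_of_lt_analyticOrderNatAt hgd hp1))
      (by linarith)
    obtain ⟨q, hq, rfl⟩ := hsurj c p ((hT' c p).2 ⟨hc, hp1⟩)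
    have h1 := (hS c q).1 hq
    refine ⟨q, ⟨h1.2, ?_⟩, rfl⟩
    have h2 := (hdist _ _ h1.1 _ hc).2
    have h3 : |q.1.im| ≤ |q.1.im - (f q).1.im| + |(f q).1.im| := by
      simpa using abs_add_le (q.1.im - (f q).1.im) (f q).1.im
    linarith

end SelfSimilar

namespace SelfSimilar
variable {m N : ℕ} {Φ : SelfSimilarSystem m N} {F : Set (EuclideanSpace ℝ (Fin m))}

/-! ## Complex dimensions -/

lemma one_sub_sum_cpow_eq (Φ : SelfSimilarSystem m N) :
    (fun s : ℂ => 1 - ∑ j, (Φ.ratio j : ℂ) ^ s) =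
      dirichletPoly (fun j => -Real.log (Φ.ratio j)) 1 := by
  funext s
  simp only [dirichletPoly, Pi.one_apply, one_mul]
  congr 1
  refine Finset.sum_congr rfl fun j _ => ?_
  rw [Complex.cpow_def_of_ne_zero (Complex.ofReal_ne_zero.2 (Φ.ratio_pos j).ne'),
    ← Complex.ofReal_log (Φ.ratio_pos j).le]
  congr 1
  push_cast
  ring

lemma neg_log_ratio_pos (Φ : SelfSimilarSystem m N) (j : Fin N) : 0 < -Real.log (Φ.ratio j) :=
  neg_pos.2 (Real.log_neg (Φ.ratio_pos j) (Φ.ratio_lt_one j))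

lemma rootMultiplicity_eq (Φ : SelfSimilarSystem m N) :
    rootMultiplicity Φ.ratio =
      analyticOrderNatAt (dirichletPoly (fun j => -Real.log (Φ.ratio j)) 1) := by
  funext ω
  rw [rootMultiplicity, one_sub_sum_cpow_eq]

/-- Two meromorphic extensions of the box-counting zeta function have the same orders. -/
lemma IsZetaExtension.meromorphicOrderAt_eq {A : Set (EuclideanSpace ℝ (Fin m))} {g g' : ℂ → ℂ}
    (hg : IsZetaExtension A g) (hg' : IsZetaExtension A g') (ω : ℂ) :
    meromorphicOrderAt g ω = meromorphicOrderAt g' ω := by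
  have hmer : MeromorphicOn (g - g') Set.univ := hg.1.sub hg'.1
  set s₀ : ℂ := ((boxAbscissa A + 1 : ℝ) : ℂ) with hs₀
  have hopen : IsOpen {s : ℂ | boxAbscissa A < s.re} :=
    isOpen_lt continuous_const Complex.continuous_re
  -- The extensions agree near a point of the half-plane of convergence; infinite order of the
  -- difference spreads over the connected plane.
  have htop : meromorphicOrderAt (g - g') s₀ = ⊤ := by
    rw [meromorphicOrderAt_eq_top_iff]
    refine mem_nhdsWithin_of_mem_nhds ?_
    filter_upwards [hopen.mem_nhds (by simp [hs₀] : s₀ ∈ {s : ℂ | boxAbscissa A < s.re})] with s hs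
    rw [Pi.sub_apply, hg.2 s hs, hg'.2 s hs, sub_self]
  have hall : meromorphicOrderAt (g - g') ω = ⊤ := by
    by_contra h
    exact hmer.meromorphicOrderAt_ne_top_of_isPreconnected isPreconnected_univ
      (Set.mem_univ ω) (Set.mem_univ s₀) h htop
  rw [meromorphicOrderAt_eq_top_iff] at hall
  refine meromorphicOrderAt_congr ?_
  filter_upwards [hall] with s hs using sub_eq_zero.1 hs

/-- The closed form of the box-counting zeta function. -/
def zetaExtension (Φ : SelfSimilarSystem m N) (F : Set (EuclideanSpace ℝ (Fin m))) : ℂ → ℂ :=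
  (fun s : ℂ => (boxJump F 0 : ℂ) ^ (-s)) +
    numerator Φ F / dirichletPoly (fun j => -Real.log (Φ.ratio j)) 1

variable {δ : ℝ}

lemma finite_support_renewalGap_of_disjoint (hF : IsAttractor Φ F)
    (hδ : IsDeltaDisjoint Φ F δ) : (Function.support (renewalGap Φ F)).Finite :=
  finite_support_renewalGap hF.2.1 (infinite_attractor hF hδ)
    fun _ hx => renewalError_eq_zero hF hδ hx

lemma mem_moranRoots_iff {ω : ℂ} :
    ω ∈ moranRoots Φ.ratio ↔ dirichletPoly (fun j => -Real.log (Φ.ratio j)) 1 ω = 0 := by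
  rw [← one_sub_sum_cpow_eq, sub_eq_zero, eq_comm]
  rfl

lemma analyticAt_boxJump_cpow (hF : IsAttractor Φ F) (hδ : IsDeltaDisjoint Φ F δ) (ω : ℂ) :
    AnalyticAt ℂ (fun s : ℂ => (boxJump F 0 : ℂ) ^ (-s)) ω := by
  have h0 := (boxCount_boxJump hF.2.1 (infinite_attractor hF hδ) 0).1
  have : Differentiable ℂ (fun s : ℂ => (boxJump F 0 : ℂ) ^ (-s)) := fun s =>
    differentiableAt_id.neg.const_cpow (Or.inl (Complex.ofReal_ne_zero.2 h0.ne'))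
  exact this.analyticAt ω

lemma isZetaExtension_zetaExtension (hF : IsAttractor Φ F) (hδ : IsDeltaDisjoint Φ F δ)
    (hnum : ∀ s : ℂ, numerator Φ F s = 0 → s ∉ moranRoots Φ.ratio) :
    IsZetaExtension F (zetaExtension Φ F) := by
  have hinf := infinite_attractor hF hδ
  have hfin := finite_support_renewalGap_of_disjoint hF hδ
  constructor
  · intro ω _
    exact (analyticAt_boxJump_cpow hF hδ ω).meromorphicAt.add
      (((differentiable_numerator hF.2.1 hinf hfin).analyticAt ω).meromorphicAt.div
        ((differentiable_dirichletPoly _ _).analyticAt ω).meromorphicAt)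
  · intro s hs
    have h := boxZeta_mul_eq hF.2.1 hinf hfin (summable_of_boxAbscissa_lt hF hδ hs)
    rw [show 1 - ∑ j, (Φ.ratio j : ℂ) ^ s = dirichletPoly (fun j => -Real.log (Φ.ratio j)) 1 s from
      congrFun (one_sub_sum_cpow_eq Φ) s] at h
    -- A Moran root in the half-plane of convergence would make h vanish there by the product
    -- formula. The closed form therefore agrees with ζ_B at every point, with no division by zero.
    have h0 : dirichletPoly (fun j => -Real.log (Φ.ratio j)) 1 s ≠ 0 := by
      intro h0
      rw [h0, mul_zero] at h
      exact hnum s h.symm (mem_moranRoots_iff.2 h0)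
    rw [zetaExtension, Pi.add_apply, Pi.div_apply, ← h, mul_div_cancel_right₀ _ h0]
    ring

lemma meromorphicOrderAt_zetaExtension_nonneg (hF : IsAttractor Φ F) (hδ : IsDeltaDisjoint Φ F δ)
    {ω : ℂ} (hω : ω ∉ moranRoots Φ.ratio) : 0 ≤ meromorphicOrderAt (zetaExtension Φ F) ω := by
  rw [mem_moranRoots_iff] at hω
  exact ((analyticAt_boxJump_cpow hF hδ ω).add
    (((differentiable_numerator hF.2.1 (infinite_attractor hF hδ)
      (finite_support_renewalGap_of_disjoint hF hδ)).analyticAt ω).div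
        ((differentiable_dirichletPoly _ _).analyticAt ω) hω)).meromorphicOrderAt_nonneg

/-- At a root the numerator is nonzero, so the quotient has a pole of the order of the root, and the
entire term x_1^{-s} cannot affect it. -/
lemma meromorphicOrderAt_zetaExtension (hF : IsAttractor Φ F) (hδ : IsDeltaDisjoint Φ F δ)
    (hnum : ∀ s : ℂ, numerator Φ F s = 0 → s ∉ moranRoots Φ.ratio) {ω : ℂ}
    (hω : ω ∈ moranRoots Φ.ratio) :
    0 < rootMultiplicity Φ.ratio ω ∧
      meromorphicOrderAt (zetaExtension Φ F) ω = ((-rootMultiplicity Φ.ratio ω : ℤ) : WithTop ℤ) := by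
  set P := dirichletPoly (fun j => -Real.log (Φ.ratio j)) 1 with hP
  have hPa : AnalyticAt ℂ P ω := (differentiable_dirichletPoly _ _).analyticAt ω
  have hna : AnalyticAt ℂ (numerator Φ F) ω :=
    (differentiable_numerator hF.2.1 (infinite_attractor hF hδ)
      (finite_support_renewalGap_of_disjoint hF hδ)).analyticAt ω
  have hn0 : numerator Φ F ω ≠ 0 := fun h => hnum ω h hω
  obtain ⟨z₀, hz₀⟩ := exists_dirichletPoly_ne_zero (neg_log_ratio_pos Φ) 1
  have hmult : analyticOrderAt P ω = (rootMultiplicity Φ.ratio ω : ℕ∞) := by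
    rw [rootMultiplicity_eq, Nat.cast_analyticOrderNatAt]
    exact analyticOrderAt_ne_top_of_ne_zero (differentiable_dirichletPoly _ _) hz₀ ω
  have hpos : 0 < rootMultiplicity Φ.ratio ω := by
    rw [Nat.pos_iff_ne_zero]
    intro h
    rw [h, Nat.cast_zero, hPa.analyticOrderAt_eq_zero] at hmult
    exact hmult (mem_moranRoots_iff.1 hω)
  refine ⟨hpos, ?_⟩
  have hquot : meromorphicOrderAt (numerator Φ F / P) ω =
      ((-rootMultiplicity Φ.ratio ω : ℤ) : WithTop ℤ) := by
    rw [meromorphicOrderAt_div hna.meromorphicAt hPa.meromorphicAt, hna.meromorphicOrderAt_eq,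
      hna.analyticOrderAt_eq_zero.2 hn0, hPa.meromorphicOrderAt_eq, hmult]
    simp
  rw [zetaExtension, meromorphicOrderAt_add_eq_right_of_lt
    (analyticAt_boxJump_cpow hF hδ ω).meromorphicAt, hquot]
  rw [hquot]
  refine lt_of_lt_of_le ?_ (analyticAt_boxJump_cpow hF hδ ω).meromorphicOrderAt_nonneg
  exact_mod_cast (by omega : (-rootMultiplicity Φ.ratio ω : ℤ) < 0)

theorem complexDimensions_eq (hF : IsAttractor Φ F) (hδ : IsDeltaDisjoint Φ F δ)
    (hnum : ∀ s : ℂ, numerator Φ F s = 0 → s ∉ moranRoots Φ.ratio) :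
    complexDimensions F = moranRoots Φ.ratio := by
  have hext := isZetaExtension_zetaExtension hF hδ hnum
  ext ω
  constructor
  · rintro ⟨g, hg, hlt⟩
    by_contra hω
    rw [hg.meromorphicOrderAt_eq hext] at hlt
    exact hlt.not_ge (meromorphicOrderAt_zetaExtension_nonneg hF hδ hω)
  · intro hω
    obtain ⟨h1, h2⟩ := meromorphicOrderAt_zetaExtension hF hδ hnum hω
    refine ⟨_, hext, ?_⟩
    rw [h2]
    exact_mod_cast (by omega : (-rootMultiplicity Φ.ratio ω : ℤ) < 0)

theorem dimensionMultiplicity_eq (hF : IsAttractor Φ F) (hδ : IsDeltaDisjoint Φ F δ)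
    (hnum : ∀ s : ℂ, numerator Φ F s = 0 → s ∉ moranRoots Φ.ratio) :
    dimensionMultiplicity F = rootMultiplicity Φ.ratio := by
  have hext := isZetaExtension_zetaExtension hF hδ hnum
  have hex : ∃ g, IsZetaExtension F g := ⟨_, hext⟩
  funext ω
  rw [dimensionMultiplicity, dif_pos hex, hex.choose_spec.meromorphicOrderAt_eq hext]
  by_cases hω : ω ∈ moranRoots Φ.ratio
  · rw [(meromorphicOrderAt_zetaExtension hF hδ hnum hω).2]
    simp
  · have h0 : rootMultiplicity Φ.ratio ω = 0 := by
      by_contra h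
      rw [rootMultiplicity_eq] at h
      exact hω (mem_moranRoots_iff.2 (eq_zero_of_lt_analyticOrderNatAt
        (differentiable_dirichletPoly _ _) (Nat.pos_of_ne_zero h)))
    have hnn := meromorphicOrderAt_zetaExtension_nonneg hF hδ hω
    rw [h0]
    cases h : meromorphicOrderAt (zetaExtension Φ F) ω with
    | top => simp
    | coe k =>
      rw [h] at hnn
      have : 0 ≤ k := by exact_mod_cast hnn
      simpa using this

end SelfSimilar

namespace SelfSimilar
variable {m N : ℕ}

/-! ## Lattice approximations of scaling vectors -/

/-- Logarithms give k_i k'_j = k_j k'_i. Taking the gcd over i, with both gcds equal to 1, yields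
k'_j = k_j. Hence the period does not depend on the choice in `oscillatoryPeriod`. -/
lemma IsLatticeGenerator.unique {r : Fin N → ℝ} {b b' : ℝ} (h : IsLatticeGenerator r b)
    (h' : IsLatticeGenerator r b') : b = b' := by
  obtain ⟨hb0, hb1, k, hk, hgcd, hr⟩ := h
  obtain ⟨hb0', hb1', k', hk', hgcd', hr'⟩ := h'
  have hL : Real.log b ≠ 0 := (Real.log_neg hb0 hb1).ne
  have hL' : Real.log b' ≠ 0 := (Real.log_neg hb0' hb1').ne
  have hlog : ∀ j, (k j : ℝ) * Real.log b = k' j * Real.log b' := fun j => by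
    rw [← Real.log_pow, ← Real.log_pow, ← hr, ← hr']
  have hcross : ∀ i j, k i * k' j = k j * k' i := by
    intro i j
    have h1 := hlog i
    have h2 := hlog j
    have h3 : ((k i * k' j : ℕ) : ℝ) * (Real.log b * Real.log b') =
        ((k j * k' i : ℕ) : ℝ) * (Real.log b * Real.log b') := by
      push_cast
      calc (k i * k' j : ℝ) * (Real.log b * Real.log b') =
          (k i * Real.log b) * (k' j * Real.log b') := by ring
        _ = (k' i * Real.log b') * (k j * Real.log b) := by rw [h1, h2]
        _ = _ := by ring
    exact_mod_cast mul_right_cancel₀ (mul_ne_zero hL hL') h3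
  have hkk : ∀ j, k j = k' j := by
    intro j
    have h1 : Finset.univ.gcd (fun i => k i * k' j) = Finset.univ.gcd (fun i => k j * k' i) :=
      congrArg _ (funext fun i => hcross i j)
    rw [Finset.gcd_mul_right, Finset.gcd_mul_left, hgcd, hgcd'] at h1
    simpa using h1.symm
  have hne : Nonempty (Fin N) := by
    by_contra hemp
    rw [not_nonempty_iff] at hemp
    simp at hgcd
  obtain ⟨j⟩ := hne
  have h1 := hlog j
  rw [← hkk j] at h1
  have h2 := mul_left_cancel₀ (Nat.cast_ne_zero.2 (hk j).ne') h1
  exact Real.log_injOn_pos hb0 hb0' h2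

lemma oscillatoryPeriod_eq {r : Fin N → ℝ} {b : ℝ} (h : IsLatticeGenerator r b) :
    oscillatoryPeriod r = 2 * Real.pi / Real.log b⁻¹ := by
  have hex : IsLattice r := ⟨b, h⟩
  rw [oscillatoryPeriod, dif_pos hex, IsLatticeGenerator.unique hex.choose_spec h]

/-- Simultaneous Diophantine approximation. -/
lemma exists_simultaneous_approximation (w : Fin N → ℝ) {Q : ℕ} (hQ : 0 < Q) :
    ∃ q : ℕ, 0 < q ∧ ∀ j, |q * w j - round (q * w j)| < 1 / Q := by
  have hQ' : (0 : ℝ) < Q := by exact_mod_cast hQ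
  have hlt : ∀ x : ℝ, ⌊Q * Int.fract x⌋.toNat < Q := by
    intro x
    have h1 : (Q : ℝ) * Int.fract x < Q := mul_lt_of_lt_one_right hQ' (Int.fract_lt_one x)
    have h2 : ⌊Q * Int.fract x⌋ < (Q : ℤ) := Int.floor_lt.2 (by exact_mod_cast h1)
    omega
  -- Pigeonhole: infinitely many n share finitely many boxes of side 1/Q for the fractional parts of
  -- n w_j; q is a difference of two n in one box.
  let f : ℕ → Fin N → Fin Q := fun n j => ⟨⌊Q * Int.fract (n * w j)⌋.toNat, hlt _⟩
  obtain ⟨n₁, n₂, hne, heq⟩ := Finite.exists_ne_map_eq_of_infinite f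
  wlog h : n₁ < n₂ generalizing n₁ n₂
  · exact this n₂ n₁ hne.symm heq.symm (by omega)
  refine ⟨n₂ - n₁, by omega, fun j => ?_⟩
  have h0 : ∀ n : ℕ, 0 ≤ ⌊Q * Int.fract (n * w j)⌋ := fun n =>
    Int.floor_nonneg.2 (mul_nonneg hQ'.le (Int.fract_nonneg _))
  have hfl : ⌊Q * Int.fract (n₁ * w j)⌋ = ⌊Q * Int.fract (n₂ * w j)⌋ := by
    have := congrArg Fin.val (congrFun heq j)
    simp only [f] at this
    have h1 := h0 n₁
    have h2 := h0 n₂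
    omega
  have h1 := Int.abs_sub_lt_one_of_floor_eq_floor hfl
  rw [← mul_sub, abs_mul, abs_of_pos hQ', mul_comm, ← lt_div_iff₀ hQ'] at h1
  refine (round_le _ (⌊n₂ * w j⌋ - ⌊n₁ * w j⌋)).trans_lt ?_
  rw [abs_sub_comm] at h1
  convert h1 using 2
  rw [Nat.cast_sub h.le, Int.fract, Int.fract]
  push_cast
  ring

/-- Take w'_j = p_j/q with p_j the integer nearest to q w_j, positive because 1/Q < w_j. With d the
gcd of the p_j the generator is e^{-d/q} and the period 2πq/d, so an error below 1/(Qq) times the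
period is at most 2π/Q. Equal weights have equal p_j. -/
lemma exists_lattice_approximation [Nonempty (Fin N)] {w : Fin N → ℝ} {Q : ℕ} (hQ : 0 < Q)
    (hw : ∀ j, 1 / (Q : ℝ) < w j) :
    ∃ (w' : Fin N → ℝ) (b : ℝ), (∀ j, 0 < w' j) ∧
      IsLatticeGenerator (fun j => Real.exp (-w' j)) b ∧ (∀ j, Real.log b⁻¹ ≤ w' j) ∧
      (∀ j, |w' j - w j| ≤ 1 / Q) ∧
      (∀ j, |w' j - w j| * (2 * Real.pi / Real.log b⁻¹) ≤ 2 * Real.pi / Q) ∧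
      ∀ i j, w i = w j → w' i = w' j := by
  have hQ' : (0 : ℝ) < Q := by exact_mod_cast hQ
  obtain ⟨q, hq, happ⟩ := exists_simultaneous_approximation w hQ
  have hq1 : (1 : ℝ) ≤ q := by exact_mod_cast hq
  have hq0 : (0 : ℝ) < q := by linarith
  set p : Fin N → ℕ := fun j => (round (q * w j)).toNat with hp
  have hpos : ∀ j, 0 < round (q * w j) := by
    intro j
    have h1 := abs_lt.1 (happ j)
    have h2 := hw j
    have h3 : (0 : ℝ) < 1 / Q := by positivity
    have h4 : w j ≤ q * w j := le_mul_of_one_le_left (h3.trans h2).le hq1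
    have : (0 : ℝ) < round (q * w j) := by linarith
    exact_mod_cast this
  have hpc : ∀ j, (p j : ℝ) = round (q * w j) := by
    intro j
    have : ((p j : ℤ) : ℝ) = round (q * w j) := by
      rw [hp, Int.toNat_of_nonneg (hpos j).le]
    exact_mod_cast this
  have hp0 : ∀ j, 0 < p j := fun j => by
    have := hpos j
    simp only [hp]
    omega
  obtain ⟨k, hk, hgcd⟩ := Finset.extract_gcd p (Finset.univ_nonempty (α := Fin N))
  set d := Finset.univ.gcd p with hd
  have hk' : ∀ j, p j = d * k j := fun j => hk j (Finset.mem_univ j)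
  have hk0 : ∀ j, 0 < k j := fun j => by
    rw [Nat.pos_iff_ne_zero]
    intro h
    have := hk' j
    rw [h, mul_zero] at this
    exact (hp0 j).ne' this
  obtain ⟨j₀⟩ := ‹Nonempty (Fin N)›
  have hd0 : 0 < d := by
    rw [Nat.pos_iff_ne_zero]
    intro h
    have := hk' j₀
    rw [h, zero_mul] at this
    exact (hp0 j₀).ne' this
  have hd1 : (1 : ℝ) ≤ d := by exact_mod_cast hd0
  have hdpos : (0 : ℝ) < d := by linarith
  have hlogb : Real.log (Real.exp (-(d / q)))⁻¹ = d / q := by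
    rw [← Real.exp_neg, Real.log_exp, neg_neg]
  have herr : ∀ j, |(p j : ℝ) / q - w j| * q < 1 / Q := by
    intro j
    have h1 := happ j
    rw [← hpc j, abs_sub_comm] at h1
    have h2 : (p j : ℝ) / q - w j = (p j - q * w j) / q := by field_simp
    rwa [h2, abs_div, abs_of_pos hq0, div_mul_cancel₀ _ hq0.ne']
  refine ⟨fun j => p j / q, Real.exp (-(d / q)), fun j => ?_, ⟨Real.exp_pos _, ?_, k, hk0, hgcd,
    fun j => ?_⟩, fun j => ?_, fun j => ?_, fun j => ?_, fun i j hij => ?_⟩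
  · have : (0 : ℝ) < p j := by exact_mod_cast hp0 j
    positivity
  · rw [Real.exp_lt_one_iff]
    have : (0 : ℝ) < d / q := by positivity
    linarith
  · change Real.exp (-((p j : ℝ) / q)) = _
    rw [← Real.exp_nat_mul, hk' j]
    congr 1
    push_cast
    ring
  · rw [hlogb]
    have : (d : ℝ) ≤ p j := by
      rw [hk' j]
      exact_mod_cast Nat.le_mul_of_pos_right d (hk0 j)
    exact div_le_div_of_nonneg_right this hq0.le
  · exact (le_mul_of_one_le_right (abs_nonneg _) hq1).trans (herr j).le
  · rw [hlogb]
    calc |(p j : ℝ) / q - w j| * (2 * Real.pi / (d / q)) =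
        (|(p j : ℝ) / q - w j| * q) * (2 * Real.pi / d) := by field_simp
      _ ≤ (1 / Q) * (2 * Real.pi / 1) := by
          have := (herr j).le
          have := Real.pi_pos
          gcongr
      _ = _ := by ring
  · simp only [hp, hij]

/-! ## Perturbations of self-similar systems -/

/-- The system with the same similarities, rescaled about the images of the origin so that the
ratios become `r`. -/
def rescale (Φ : SelfSimilarSystem m N) (r : Fin N → ℝ) (h0 : ∀ j, 0 < r j) (h1 : ∀ j, r j < 1) :
    SelfSimilarSystem m N where
  map j x := Φ.map j 0 + (r j / Φ.ratio j) • (Φ.map j x - Φ.map j 0)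
  ratio := r
  two_le := Φ.two_le
  ratio_pos := h0
  ratio_lt_one := h1
  dist_map j x y := by
    have hΦ := Φ.ratio_pos j
    rw [dist_add_left, dist_smul₀, dist_sub_right, Φ.dist_map, Real.norm_of_nonneg
      (div_pos (h0 j) hΦ).le, ← mul_assoc, div_mul_cancel₀ _ hΦ.ne']

lemma dist_map_rescale (Φ : SelfSimilarSystem m N) (r : Fin N → ℝ) (h0 : ∀ j, 0 < r j)
    (h1 : ∀ j, r j < 1) (j : Fin N) (x : EuclideanSpace ℝ (Fin m)) :
    dist (Φ.map j x) ((rescale Φ r h0 h1).map j x) = |r j - Φ.ratio j| * ‖x‖ := by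
  have hΦ := Φ.ratio_pos j
  have h : Φ.map j x - (rescale Φ r h0 h1).map j x =
      (1 - r j / Φ.ratio j) • (Φ.map j x - Φ.map j 0) := by
    simp only [rescale, sub_smul, one_smul]
    abel
  rw [dist_eq_norm, h, norm_smul, ← dist_eq_norm (Φ.map j x), Φ.dist_map, dist_zero_right, ← mul_assoc,
    Real.norm_eq_abs, abs_sub_comm]
  congr 1
  rw [← abs_of_pos hΦ, ← abs_mul, abs_of_pos hΦ, sub_mul, div_mul_cancel₀ _ hΦ.ne', one_mul]

lemma continuous_map (Φ : SelfSimilarSystem m N) (j : Fin N) : Continuous (Φ.map j) :=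
  (LipschitzWith.of_dist_le_mul (K := ⟨Φ.ratio j, (Φ.ratio_pos j).le⟩)
    fun x y => (Φ.dist_map j x y).le).continuous

lemma exists_dist_le_hausdorffDist {K L : Set (EuclideanSpace ℝ (Fin m))} (hK : IsCompact K)
    (hL : IsCompact L) (hLne : L.Nonempty) {x : EuclideanSpace ℝ (Fin m)} (hx : x ∈ K) :
    ∃ y ∈ L, dist x y ≤ Metric.hausdorffDist K L := by
  obtain ⟨y, hy, h⟩ := hL.exists_infDist_eq_dist hLne x
  exact ⟨y, hy, h ▸ Metric.infDist_le_hausdorffDist_of_mem hx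
    (Metric.hausdorffEDist_ne_top_of_nonempty_of_bounded ⟨x, hx⟩ hLne hK.isBounded hL.isBounded)⟩

/-- The Hutchinson operator of a self-similar system. -/
def hutchinson (Φ : SelfSimilarSystem m N)
    (K : TopologicalSpace.NonemptyCompacts (EuclideanSpace ℝ (Fin m))) :
    TopologicalSpace.NonemptyCompacts (EuclideanSpace ℝ (Fin m)) where
  carrier := ⋃ j, Φ.map j '' K
  isCompact' := isCompact_iUnion fun j => K.isCompact.image (continuous_map Φ j)
  nonempty' := by
    have := Φ.two_le
    exact Set.nonempty_iUnion.2 ⟨⟨0, by omega⟩, K.nonempty.image _⟩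

/-- The Hutchinson operator contracts the Hausdorff metric by the largest ratio; the attractor is
its fixed point. -/
lemma exists_isAttractor (Φ : SelfSimilarSystem m N) : ∃ F, IsAttractor Φ F := by
  have h2 := Φ.two_le
  have : Nonempty (Fin N) := ⟨⟨0, by omega⟩⟩
  obtain ⟨i, hi⟩ := Finite.exists_max Φ.ratio
  have hR0 := (Φ.ratio_pos i).le
  have key : ∀ K L : TopologicalSpace.NonemptyCompacts (EuclideanSpace ℝ (Fin m)),
      ∀ x ∈ hutchinson Φ K, ∃ y ∈ hutchinson Φ L, dist x y ≤ Φ.ratio i * dist K L := by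
    intro K L x hx
    obtain ⟨j, x', hx', rfl⟩ := Set.mem_iUnion.1 hx
    obtain ⟨y', hy', h⟩ := exists_dist_le_hausdorffDist K.isCompact L.isCompact L.nonempty hx'
    refine ⟨Φ.map j y', Set.mem_iUnion.2 ⟨j, y', hy', rfl⟩, ?_⟩
    rw [Φ.dist_map]
    exact mul_le_mul (hi j) h dist_nonneg hR0
  have hcontr : ContractingWith ⟨Φ.ratio i, hR0⟩ (hutchinson Φ) := by
    refine ⟨by exact_mod_cast Φ.ratio_lt_one i, LipschitzWith.of_dist_le_mul fun K L => ?_⟩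
    refine Metric.hausdorffDist_le_of_mem_dist (mul_nonneg hR0 dist_nonneg) (key K L) ?_
    intro x hx
    have := key L K x hx
    rwa [dist_comm L K] at this
  have : Nonempty (TopologicalSpace.NonemptyCompacts (EuclideanSpace ℝ (Fin m))) := ⟨{0}⟩
  set K := hcontr.fixedPoint
  have hfix : hutchinson Φ K = K := hcontr.fixedPoint_isFixedPt
  exact ⟨K, K.nonempty, K.isCompact, congrArg
    (fun L : TopologicalSpace.NonemptyCompacts _ => (L : Set (EuclideanSpace ℝ (Fin m)))) hfix⟩

/-- Stability of the attractor and of its pieces under perturbations of the system. -/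
lemma attractor_stability {Φ Ψ : SelfSimilarSystem m N} {F G : Set (EuclideanSpace ℝ (Fin m))}
    (hF : IsAttractor Φ F) (hG : IsAttractor Ψ G) {R η : ℝ} (hR : R < 1) (hη : 0 ≤ η)
    (hΨ : ∀ j, Ψ.ratio j ≤ R) (hd : ∀ j, ∀ x ∈ F, dist (Φ.map j x) (Ψ.map j x) ≤ η) :
    Metric.hausdorffDist G F ≤ η / (1 - R) ∧
      (∀ j, ∀ x ∈ Φ.map j '' F, ∃ y ∈ Ψ.map j '' G, dist x y ≤ η / (1 - R)) ∧
      ∀ j, ∀ y ∈ Ψ.map j '' G, ∃ x ∈ Φ.map j '' F, dist y x ≤ η / (1 - R) := by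
  have h2 := Φ.two_le
  have hR0 : 0 < R := (Ψ.ratio_pos ⟨0, by omega⟩).trans_le (hΨ _)
  set h := Metric.hausdorffDist G F with hh
  have hh0 : 0 ≤ h := Metric.hausdorffDist_nonneg
  have k1 : ∀ j, ∀ x ∈ Φ.map j '' F, ∃ y ∈ Ψ.map j '' G, dist x y ≤ R * h + η := by
    rintro j _ ⟨x, hx, rfl⟩
    obtain ⟨y, hy, hxy⟩ := exists_dist_le_hausdorffDist hF.2.1 hG.2.1 hG.1 hx
    rw [Metric.hausdorffDist_comm, ← hh] at hxy
    refine ⟨_, ⟨y, hy, rfl⟩, ?_⟩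
    have h3 := dist_triangle (Φ.map j x) (Ψ.map j x) (Ψ.map j y)
    rw [Ψ.dist_map] at h3
    have h4 := mul_le_mul (hΨ j) hxy dist_nonneg hR0.le
    linarith [hd j x hx]
  have k2 : ∀ j, ∀ y ∈ Ψ.map j '' G, ∃ x ∈ Φ.map j '' F, dist y x ≤ R * h + η := by
    rintro j _ ⟨y, hy, rfl⟩
    obtain ⟨x, hx, hxy⟩ := exists_dist_le_hausdorffDist hG.2.1 hF.2.1 hF.1 hy
    refine ⟨_, ⟨x, hx, rfl⟩, ?_⟩
    have h3 := dist_triangle_right (Ψ.map j y) (Φ.map j x) (Ψ.map j x)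
    rw [Ψ.dist_map] at h3
    have h4 := mul_le_mul (hΨ j) hxy dist_nonneg hR0.le
    linarith [hd j x hx]
  -- The Hausdorff distance h of the attractors reappears, contracted, on the right; solving for h
  -- gives η/(1 - R), which also bounds R h + η.
  have hle : h ≤ R * h + η := by
    refine Metric.hausdorffDist_le_of_mem_dist (by positivity) (fun y hy => ?_) fun x hx => ?_
    · rw [← hG.2.2] at hy
      obtain ⟨j, hj⟩ := Set.mem_iUnion.1 hy
      obtain ⟨x, hx, hxy⟩ := k2 j y hj
      exact ⟨x, hF.2.2 ▸ Set.mem_iUnion.2 ⟨j, hx⟩, hxy⟩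
    · rw [← hF.2.2] at hx
      obtain ⟨j, hj⟩ := Set.mem_iUnion.1 hx
      obtain ⟨y, hy, hxy⟩ := k1 j x hj
      exact ⟨y, hG.2.2 ▸ Set.mem_iUnion.2 ⟨j, hy⟩, hxy⟩
  have h1R : 0 < 1 - R := by linarith
  have hb : h ≤ η / (1 - R) := by
    rw [le_div_iff₀ h1R]
    linarith
  have hb2 : R * h + η ≤ η / (1 - R) := by
    have := mul_le_mul_of_nonneg_left hb hR0.le
    have h5 : R * (η / (1 - R)) + η = η / (1 - R) := by
      field_simp
      ring
    linarith
  exact ⟨hb, fun j x hx => (k1 j x hx).imp fun y hy => ⟨hy.1, hy.2.trans hb2⟩,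
    fun j y hy => (k2 j y hy).imp fun x hx => ⟨hx.1, hx.2.trans hb2⟩⟩

/-- The numbers that are smaller than all distances between points of distinct pieces. -/
def gapSet (Φ : SelfSimilarSystem m N) (F : Set (EuclideanSpace ℝ (Fin m))) : Set ℝ :=
  {α : ℝ | ∀ j k, j ≠ k → ∀ x ∈ Φ.map j '' F, ∀ y ∈ Φ.map k '' F, α < dist x y}

/-- The real supremum is genuine: -1 belongs to the set, and two distinct pieces, available since N
≥ 2, bound it. -/
lemma isLUB_gapSet {Φ : SelfSimilarSystem m N} {F : Set (EuclideanSpace ℝ (Fin m))}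
    (hF : F.Nonempty) : IsLUB (gapSet Φ F) (sSup (gapSet Φ F)) := by
  have h2 := Φ.two_le
  obtain ⟨x, hx⟩ := hF
  refine isLUB_csSup ⟨-1, fun j k _ x _ y _ => ?_⟩
    ⟨dist (Φ.map ⟨0, by omega⟩ x) (Φ.map ⟨1, by omega⟩ x), fun α hα => ?_⟩
  · linarith [dist_nonneg (x := x) (y := y)]
  · exact (hα _ _ (by simp) _ ⟨x, hx, rfl⟩ _ ⟨x, hx, rfl⟩).le

lemma isDeltaDisjoint_sSup_gapSet {Φ : SelfSimilarSystem m N}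
    {F : Set (EuclideanSpace ℝ (Fin m))} (hF : F.Nonempty) (h : 0 < sSup (gapSet Φ F)) :
    IsDeltaDisjoint Φ F (sSup (gapSet Φ F)) := by
  have hlub := isLUB_gapSet (Φ := Φ) hF
  refine ⟨fun j k hjk => ?_, hlub, h⟩
  obtain ⟨α, hα, h0, -⟩ := hlub.exists_between h
  rw [Set.disjoint_left]
  intro x hx hx'
  have := hα j k hjk x hx x hx'
  rw [dist_self] at this
  linarith

/-- Moving both points by at most κ costs 2κ. Applied in both directions, this gives convergence of
the gaps. -/
lemma sSup_gapSet_le {Φ Ψ : SelfSimilarSystem m N} {F G : Set (EuclideanSpace ℝ (Fin m))}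
    (hF : F.Nonempty) (hG : G.Nonempty) {κ : ℝ}
    (h : ∀ j, ∀ y ∈ Ψ.map j '' G, ∃ x ∈ Φ.map j '' F, dist y x ≤ κ) :
    sSup (gapSet Φ F) ≤ sSup (gapSet Ψ G) + 2 * κ := by
  refine (isLUB_gapSet hF).2 fun α hα => ?_
  have : α - 2 * κ ∈ gapSet Ψ G := by
    intro j k hjk y hy y' hy'
    obtain ⟨x, hx, hd⟩ := h j y hy
    obtain ⟨x', hx', hd'⟩ := h k y' hy'
    have h1 := hα j k hjk x hx x' hx'
    have h2 := dist_triangle4 x y y' x'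
    rw [dist_comm x y] at h2
    linarith
  linarith [(isLUB_gapSet (Φ := Ψ) hG).1 this]

end SelfSimilar

/-! ### Convergence of the approximating systems -/

namespace SelfSimilar
variable {m N : ℕ}

/-- Rescalings with ratios tending to those of a disjoint system: the attractors converge in the
Hausdorff metric and the systems are eventually disjoint, with converging gaps. -/
lemma tendsto_attractor {Φ : SelfSimilarSystem m N} {F : Set (EuclideanSpace ℝ (Fin m))} {δ : ℝ}
    (hF : IsAttractor Φ F) (hδ : IsDeltaDisjoint Φ F δ) {r : ℕ → Fin N → ℝ}
    (h0 : ∀ M j, 0 < r M j) (h1 : ∀ M j, r M j < 1)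
    (hr : ∀ j, Tendsto (fun M => r M j) atTop (𝓝 (Φ.ratio j)))
    {G : ℕ → Set (EuclideanSpace ℝ (Fin m))}
    (hG : ∀ M, IsAttractor (rescale Φ (r M) (h0 M) (h1 M)) (G M)) :
    Tendsto (fun M => Metric.hausdorffDist (G M) F) atTop (𝓝 0) ∧
      Tendsto (fun M => sSup (gapSet (rescale Φ (r M) (h0 M) (h1 M)) (G M))) atTop (𝓝 δ) ∧
      ∀ᶠ M in atTop, IsDeltaDisjoint (rescale Φ (r M) (h0 M) (h1 M)) (G M)
        (sSup (gapSet (rescale Φ (r M) (h0 M) (h1 M)) (G M))) := by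
  obtain ⟨ρ, R, -, hR0, hR1, hρR⟩ := exists_ratio_bounds Φ
  obtain ⟨B, hB⟩ := hF.2.1.isBounded.exists_norm_le
  have hB0 : 0 ≤ max B 0 := le_max_right _ _
  -- A common contraction bound strictly between R and 1, valid for all ratios eventually.
  set R' := (1 + R) / 2 with hR'
  have hR'1 : R' < 1 := by linarith
  set η : ℕ → ℝ := fun M => (∑ j, |r M j - Φ.ratio j|) * max B 0 with hη
  have hη0 : ∀ M, 0 ≤ η M := fun M =>
    mul_nonneg (Finset.sum_nonneg fun _ _ => abs_nonneg _) hB0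
  have hηt : Tendsto (fun M => η M / (1 - R')) atTop (𝓝 0) := by
    have h2 : ∀ j ∈ Finset.univ, Tendsto (fun M => |r M j - Φ.ratio j|) atTop (𝓝 0) := fun j _ => by
      have := ((hr j).sub_const (Φ.ratio j)).abs
      simpa using this
    have h3 := ((tendsto_finsetSum _ h2).mul_const (max B 0)).div_const (1 - R')
    simpa using h3
  have hst : ∀ᶠ M in atTop, Metric.hausdorffDist (G M) F ≤ η M / (1 - R') ∧
      (∀ j, ∀ x ∈ Φ.map j '' F, ∃ y ∈ (rescale Φ (r M) (h0 M) (h1 M)).map j '' G M,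
        dist x y ≤ η M / (1 - R')) ∧
      ∀ j, ∀ y ∈ (rescale Φ (r M) (h0 M) (h1 M)).map j '' G M, ∃ x ∈ Φ.map j '' F,
        dist y x ≤ η M / (1 - R') := by
    have hle : ∀ᶠ M in atTop, ∀ j, r M j ≤ R' := eventually_all.2 fun j =>
      (hr j).eventually (ge_mem_nhds (by linarith [(hρR j).2]))
    filter_upwards [hle] with M hM
    refine attractor_stability hF (hG M) hR'1 (hη0 M) hM fun j x hx => ?_
    rw [dist_map_rescale]
    exact mul_le_mul (Finset.single_le_sum (f := fun j => |r M j - Φ.ratio j|)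
      (fun _ _ => abs_nonneg _) (Finset.mem_univ j)) ((hB x hx).trans (le_max_left _ _))
      (norm_nonneg _) (Finset.sum_nonneg fun _ _ => abs_nonneg _)
  have hδeq : sSup (gapSet Φ F) = δ := (isLUB_gapSet hF.1).unique hδ.2.1
  have hgap : Tendsto (fun M => sSup (gapSet (rescale Φ (r M) (h0 M) (h1 M)) (G M))) atTop
      (𝓝 δ) := by
    rw [tendsto_iff_dist_tendsto_zero]
    have h2 := hηt.const_mul 2
    rw [mul_zero] at h2
    refine squeeze_zero' (Eventually.of_forall fun _ => dist_nonneg) ?_ h2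
    filter_upwards [hst] with M hM
    have h3 := sSup_gapSet_le hF.1 (hG M).1 hM.2.2
    have h4 := sSup_gapSet_le (hG M).1 hF.1 hM.2.1
    rw [Real.dist_eq, abs_le, ← hδeq]
    constructor <;> linarith
  refine ⟨squeeze_zero' (Eventually.of_forall fun _ => Metric.hausdorffDist_nonneg)
    (hst.mono fun M hM => hM.1) hηt, hgap, ?_⟩
  filter_upwards [hgap.eventually (lt_mem_nhds hδ.2.2)] with M hM
  exact isDeltaDisjoint_sSup_gapSet (hG M).1 hM

/-- Lattice vectors approximating `exp (-w_j)`, with errors small relative to the periods. -/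
lemma exists_lattice_sequence [Nonempty (Fin N)] {w : Fin N → ℝ} (hw : ∀ j, 0 < w j) :
    ∃ (w' : ℕ → Fin N → ℝ) (T : ℕ → ℝ), (∀ M j, 0 < w' M j) ∧
      (∀ M, IsLattice fun j => Real.exp (-w' M j)) ∧
      (∀ j, Tendsto (fun M => w' M j) atTop (𝓝 (w j))) ∧
      (∀ M i j, w i = w j → w' M i = w' M j) ∧ Tendsto T atTop atTop ∧
      (∀ j, Tendsto (fun M => |w' M j - w j| * T M) atTop (𝓝 0)) ∧
      Tendsto (fun M => oscillatoryPeriod (fun j => Real.exp (-w' M j)) / T M) atTop (𝓝 0) := by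
  obtain ⟨i, hi⟩ := Finite.exists_min w
  obtain ⟨n, hn⟩ := exists_nat_one_div_lt (hw i)
  have hQ : ∀ M j, 1 / ((M + n + 1 : ℕ) : ℝ) < w j := by
    intro M j
    refine lt_of_le_of_lt ?_ (hn.trans_le (hi j))
    push_cast
    gcongr
    simp
  choose w' b hw0 hlat hlog hclose hper htie using fun M =>
    exists_lattice_approximation (Nat.succ_pos (M + n)) (hQ M)
  set Q : ℕ → ℝ := fun M => ((M + n + 1 : ℕ) : ℝ) with hQdef
  have hQpos : ∀ M, 0 < Q M := fun M => by positivity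
  have hQt : Tendsto Q atTop atTop :=
    tendsto_natCast_atTop_atTop.comp (tendsto_atTop_mono
      (fun M => (by simp only [id]; omega : id M ≤ M + n + 1)) tendsto_id)
  have hsq : Tendsto (fun M => √(Q M)) atTop atTop := Real.tendsto_sqrt_atTop.comp hQt
  have hsqi : Tendsto (fun M => (√(Q M))⁻¹) atTop (𝓝 0) := tendsto_inv_atTop_zero.comp hsq
  set p : ℕ → ℝ := fun M => 2 * Real.pi / Real.log (b M)⁻¹ with hp
  have hlog0 : ∀ M, 0 < Real.log (b M)⁻¹ := fun M => by
    rw [Real.log_inv]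
    exact neg_pos.2 (Real.log_neg (hlat M).1 (hlat M).2.1)
  have hpi := Real.pi_pos
  have hp0 : ∀ M, 0 < p M := fun M => div_pos (by positivity) (hlog0 M)
  -- The periods stay away from 0, since log b⁻¹ ≤ w'_i ≤ w_i + 1; this forces T to infinity.
  have hplow : ∀ M, 2 * Real.pi / (w i + 1) ≤ p M := by
    intro M
    have h1 := (abs_le.1 (hclose M i)).2
    have h2 : 1 / Q M ≤ 1 := by
      rw [div_le_one (hQpos M)]
      exact Nat.one_le_cast.2 (Nat.succ_pos (M + n))
    have h3 := hlog M i
    exact div_le_div_of_nonneg_left (by positivity) (hlog0 M) (by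
      have : w' M i - w i ≤ 1 / Q M := h1
      linarith)
  have hwi := hw i
  -- The height p√Q balances two demands: p/T = 1/√Q, while an error times p of at most 2π/Q gives
  -- an error times T of at most 2π/√Q.
  refine ⟨w', fun M => p M * √(Q M), hw0, fun M => ⟨b M, hlat M⟩, fun j => ?_, htie, ?_,
    fun j => ?_, ?_⟩
  · rw [tendsto_iff_dist_tendsto_zero]
    have h1 : Tendsto (fun M => 1 / Q M) atTop (𝓝 0) :=
      (tendsto_inv_atTop_zero.comp hQt).congr fun M => (one_div _).symm
    exact squeeze_zero (fun _ => dist_nonneg) (fun M => hclose M j) h1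
  · refine tendsto_atTop_mono (fun M => ?_)
      (hsq.const_mul_atTop (by positivity : 0 < 2 * Real.pi / (w i + 1)))
    exact mul_le_mul_of_nonneg_right (hplow M) (Real.sqrt_nonneg _)
  · have h1 := hsqi.const_mul (2 * Real.pi)
    rw [mul_zero] at h1
    refine squeeze_zero (fun M => mul_nonneg (abs_nonneg _)
      (mul_nonneg (hp0 M).le (Real.sqrt_nonneg _))) (fun M => ?_) h1
    have hs : 0 < √(Q M) := Real.sqrt_pos.2 (hQpos M)
    calc |w' M j - w j| * (p M * √(Q M)) = |w' M j - w j| * p M * √(Q M) := by ring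
      _ ≤ 2 * Real.pi / Q M * √(Q M) := mul_le_mul_of_nonneg_right (hper M j) hs.le
      _ = 2 * Real.pi * (√(Q M))⁻¹ := by
        conv_lhs => rw [← Real.mul_self_sqrt (hQpos M).le]
        rw [Real.sqrt_mul_self hs.le]
        field_simp
  · refine hsqi.congr fun M => ?_
    rw [oscillatoryPeriod_eq (hlat M)]
    have hs : 0 < √(Q M) := Real.sqrt_pos.2 (hQpos M)
    change _ = p M / (p M * √(Q M))
    have := (hp0 M).ne'
    field_simp

end SelfSimilar

end

/-! ### Proof of the theorem -/

open SelfSimilar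
theorem mainTheorem7 (m N : ℕ) (Φ : SelfSimilarSystem m N)
    (F : Set (EuclideanSpace ℝ (Fin m))) (δ : ℝ)
    (hF : IsAttractor Φ F) (hδ : IsDeltaDisjoint Φ F δ)
    (hnonlattice : ¬ IsLattice Φ.ratio)
    (hnum : ∀ s : ℂ, numerator Φ F s = 0 → s ∉ moranRoots Φ.ratio) :
    ∃ (ΦM : ℕ → SelfSimilarSystem m N) (FM : ℕ → Set (EuclideanSpace ℝ (Fin m)))
      (δM : ℕ → ℝ),
      (∀ M, IsAttractor (ΦM M) (FM M)) ∧
      (∀ M, IsLattice (ΦM M).ratio) ∧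
      (∀ j, Tendsto (fun M => (ΦM M).ratio j) atTop (𝓝 (Φ.ratio j))) ∧
      Tendsto (fun M => Metric.hausdorffDist (FM M) F) atTop (𝓝 0) ∧
      (∀ᶠ M in atTop, IsDeltaDisjoint (ΦM M) (FM M) (δM M)) ∧
      Tendsto δM atTop (𝓝 δ) ∧
      complexDimensions F = moranRoots Φ.ratio ∧
      ApproximatedBy (fun M => rootMultiplicity (ΦM M).ratio)
        (fun M => oscillatoryPeriod (ΦM M).ratio) (dimensionMultiplicity F) ∧
      (∀ M₀ : ℕ,
        (∀ M ≥ M₀, IsDeltaDisjoint (ΦM M) (FM M) (δM M) ∧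
          ∀ s : ℂ, numerator (ΦM M) (FM M) s = 0 → s ∉ moranRoots (ΦM M).ratio) →
        (∀ M ≥ M₀, complexDimensions (FM M) = moranRoots (ΦM M).ratio) ∧
        ApproximatedBy (fun M => dimensionMultiplicity (FM M))
          (fun M => oscillatoryPeriod (ΦM M).ratio) (dimensionMultiplicity F)) := by
  have h2 := Φ.two_le
  have : Nonempty (Fin N) := ⟨⟨0, by omega⟩⟩
  have hw := neg_log_ratio_pos Φ
  obtain ⟨w', T, hw0, hlat, hlim, htie, hT, hwT, hper⟩ := exists_lattice_sequence hw
  have h0 : ∀ M j, 0 < Real.exp (-w' M j) := fun M j => Real.exp_pos _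
  have h1 : ∀ M j, Real.exp (-w' M j) < 1 := fun M j => by
    rw [Real.exp_lt_one_iff]
    exact neg_neg_of_pos (hw0 M j)
  have hr : ∀ j, Tendsto (fun M => Real.exp (-w' M j)) atTop (𝓝 (Φ.ratio j)) := fun j => by
    have h := (Real.continuous_exp.tendsto _).comp (hlim j).neg
    rwa [neg_neg, Real.exp_log (Φ.ratio_pos j)] at h
  set ΦM : ℕ → SelfSimilarSystem m N :=
    fun M => rescale Φ (fun j => Real.exp (-w' M j)) (h0 M) (h1 M) with hΦM
  choose FM hFM using fun M => exists_isAttractor (ΦM M)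
  obtain ⟨hHaus, hgap, hdisj⟩ := tendsto_attractor hF hδ h0 h1 hr hFM
  have hmult : ∀ M, rootMultiplicity (ΦM M).ratio =
      analyticOrderNatAt (dirichletPoly (w' M) 1) := by
    intro M
    have h3 : (fun j => -Real.log ((ΦM M).ratio j)) = w' M := by
      funext j
      change -Real.log (Real.exp (-w' M j)) = w' M j
      rw [Real.log_exp, neg_neg]
    rw [rootMultiplicity_eq, h3]
  -- One matching of Moran roots serves both convergence claims; in the conditional one the
  -- multiplicities of the dimensions equal those of the roots from `M₀` on.
  have happrox : ∀ μs : ℕ → ℂ → ℕ, (∀ᶠ M in atTop, μs M = rootMultiplicity (ΦM M).ratio) →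
      ApproximatedBy μs (fun M => oscillatoryPeriod (ΦM M).ratio) (dimensionMultiplicity F) := by
    intro μs hμs
    refine ⟨T, hT, hper, fun ε hε => ?_⟩
    rw [dimensionMultiplicity_eq hF hδ hnum, rootMultiplicity_eq]
    filter_upwards [hμs, exists_zero_matching hw w' T hT hwT (Eventually.of_forall htie) hε]
      with M hM hmatch
    rw [hM, hmult]
    exact hmatch
  refine ⟨ΦM, FM, fun M => sSup (gapSet (ΦM M) (FM M)), hFM, hlat, hr, hHaus, hdisj, hgap,
    complexDimensions_eq hF hδ hnum, happrox _ (Eventually.of_forall fun _ => rfl),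
    fun M₀ hM₀ => ⟨fun M hM => complexDimensions_eq (hFM M) (hM₀ M hM).1 (hM₀ M hM).2,
      happrox _ ?_⟩⟩
  filter_upwards [eventually_ge_atTop M₀] with M hM
  exact dimensionMultiplicity_eq (hFM M) (hM₀ M hM).1 (hM₀ M hM).2
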